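/- Let $n\ge 2$, write $\langle x\rangle=(1+|x|^2)^{1/2}$ for $x\in\mathbf R^n$, and let $p\in C^\infty(\mathbf R^n)$ be a complex-valued elliptic symbol of class $S^\mu(\mathbf R^n)$ for some real $\mu$, that is, $|\partial^\alpha p(\xi)|\le C_\alpha\langle\xi\rangle^{\mu-|\alpha|}$ for all $\xi\in\mathbf R^n$ and all multi-indices $\alpha$, and $|p(\xi)|\ge C\langle\xi\rangle^\mu$ for $|\xi|\ge A$, with constants $C>0$ and $A$. Assume that $$p(\xi)=g(\xi)\prod_{j=1}^N(|\xi|-r_j)^{q_j},\qquad \xi\in\mathbf R^n\setminus\{0\},$$ where $0<r_1<\dots<r_N$, the $q_j$ are positive integers, and $g\in C^\infty(\mathbf R^n\setminus\{0\})$ is such that $|g|$ is bounded from below by a positive constant, bounded from above as $|\xi|\to0$, and at most polynomially increasing as $|\xi|\to\infty$. Let $P$ be the operator on $\mathcal S'(\mathbf R^n)$ given by $Pu=\mathcal F^{-1}(p\,\mathcal Fu)$, where $\mathcal F\phi(\xi)=\int e^{-ix\cdot\xi}\phi(x)\,dx$ for $\phi\in\mathcal S(\mathbf R^n)$, and $\mathcal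 F$ is extended to $\mathcal S'(\mathbf R^n)$ by duality. For $d\in\mathbf N_0$ let $\mathcal S'^d(\mathbf R^n)$ be the set of $u\in\mathcal S'(\mathbf R^n)$ for which there is a constant $C$ with $$|u(\phi)|\le C\sum_{|\alpha|\le d}\sup_{x\in\mathbf R^n}\langle x\rangle^d|\partial^\alpha\phi(x)|,\qquad \phi\in\mathcal S(\mathbf R^n).$$ Fix $R>0$ and orthonormal vectors $e_1,e_2\in\mathbf R^n$, and let $\mathcal C=\{e_1R\cos\theta+e_2R\sin\theta:\ \theta\in[0,2\pi]\}$. If $u\in\mathcal S'^d(\mathbf R^n)$ solves $Pu=0$ in $\mathcal S'(\mathbf R^n)$, then $u$ is a smooth function in an open neighborhood of $\mathcal C$, and there is a constant $c$ such that the Fourier coefficients $$\widehat U^{\mathcal C}_m=\int_0^{2\pi}e^{-im\theta}\,u(e_1R\cos\theta+e_2R\sin\theta)\,d\theta$$ of its trace on $\mathcal C$ satisfy $$\bigl|\widehat U^{\mathcal C}_m\bigr|\le c\sum_{j=1}^N\Bigl(\max\{1,|m|^d\}\,|J_m(r_jR)|+\delta_{d\ge1}\max\{1,|m|^{d-1}\}\,|J_{m+1}(r_jR)|\Bigr)\qquad\text{for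 all } m\in\mathbf Z,$$ where $J_m$ is the Bessel function of the first kind of integer order $m$, and $\delta_{d\ge1}$ is $1$ if $d\ge1$ and $0$ if $d=0$. -/

import Mathlib

open scoped ContDiff SchwartzMap

noncomputable section

/-- The bracket `⟨x⟩ = (1 + |x|²)^{1/2}`. -/
def japaneseBracket {n : ℕ} (x : EuclideanSpace ℝ (Fin n)) : ℝ :=
  Real.sqrt (1 + ‖x‖ ^ 2)

/-- The Hörmander class `S^μ(ℝⁿ)` of symbols that do not depend on the base variable.  The
operator norm of the `k`-th derivative is comparable, up to constants that depend only on `k`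
and `n`, with the sum of the `|∂^α p|` over the multi-indices `α` with `|α| = k`. -/
structure IsSymbol {n : ℕ} (μ : ℝ) (p : EuclideanSpace ℝ (Fin n) → ℂ) : Prop where
  smooth : ContDiff ℝ ∞ p
  bound : ∀ k : ℕ, ∃ C : ℝ, ∀ ξ,
    ‖iteratedFDeriv ℝ k p ξ‖ ≤ C * japaneseBracket ξ ^ (μ - (k : ℝ))

/-- Ellipticity of a symbol of order `μ`. -/
def IsEllipticSymbol {n : ℕ} (μ : ℝ) (p : EuclideanSpace ℝ (Fin n) → ℂ) : Prop :=
  ∃ C : ℝ, 0 < C ∧ ∃ A : ℝ, ∀ ξ, A ≤ ‖ξ‖ → C * japaneseBracket ξ ^ μ ≤ ‖p ξ‖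

/-- The factor `g` is smooth away from the origin, bounded away from zero, bounded near the
origin and at most polynomially increasing at infinity. -/
structure IsAdmissibleFactor {n : ℕ} (g : EuclideanSpace ℝ (Fin n) → ℂ) : Prop where
  smooth : ContDiffOn ℝ ∞ g {0}ᶜ
  bounded_below : ∃ c : ℝ, 0 < c ∧ ∀ ξ, ξ ≠ 0 → c ≤ ‖g ξ‖
  bounded_near_zero : ∃ C δ : ℝ, 0 < δ ∧ ∀ ξ, ξ ≠ 0 → ‖ξ‖ < δ → ‖g ξ‖ ≤ C
  polynomial_growth : ∃ (C A : ℝ) (k : ℕ), ∀ ξ, A ≤ ‖ξ‖ → ξ ≠ 0 → ‖g ξ‖ ≤ C * ‖ξ‖ ^ k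

/-- The multiplier operator `P u = 𝓕⁻¹ (p 𝓕 u)` on tempered distributions, where the Fourier
transform has the kernel `e^{-i x·ξ}`.  Mathlib's transform has the kernel `e^{-2πi x·ξ}`, so the
symbol is evaluated at `2πξ`. -/
def multiplierOp {n : ℕ} (p : EuclideanSpace ℝ (Fin n) → ℂ) :
    𝓢'(EuclideanSpace ℝ (Fin n), ℂ) →L[ℂ] 𝓢'(EuclideanSpace ℝ (Fin n), ℂ) :=
  TemperedDistribution.fourierMultiplierCLM ℂ (fun ξ => p ((2 * Real.pi) • ξ))

/-- The class `𝓢'^d(ℝⁿ)`: the tempered distributions `u` with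
`|u(φ)| ≤ C ∑_{|α| ≤ d} sup_x ⟨x⟩^d |∂^α φ(x)|` for all Schwartz functions `φ`. -/
def IsTemperedOfOrder {n : ℕ} (d : ℕ) (u : 𝓢'(EuclideanSpace ℝ (Fin n), ℂ)) : Prop :=
  ∃ C : ℝ, ∀ φ : 𝓢(EuclideanSpace ℝ (Fin n), ℂ),
    ‖u φ‖ ≤ C * ∑ k ∈ Finset.range (d + 1),
      ⨆ x : EuclideanSpace ℝ (Fin n), japaneseBracket x ^ d * ‖iteratedFDeriv ℝ k φ x‖

/-- On the set `Ω` (open in all uses) the distribution `u` is the smooth function `U`. -/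
def IsSmoothOn {n : ℕ} (u : 𝓢'(EuclideanSpace ℝ (Fin n), ℂ))
    (Ω : Set (EuclideanSpace ℝ (Fin n))) (U : EuclideanSpace ℝ (Fin n) → ℂ) : Prop :=
  ContDiffOn ℝ ∞ U Ω ∧
    ∀ φ : 𝓢(EuclideanSpace ℝ (Fin n), ℂ), HasCompactSupport φ → tsupport φ ⊆ Ω →
      u φ = ∫ x, φ x * U x

/-- The point `e₁ R cos θ + e₂ R sin θ`. -/
def circlePoint {n : ℕ} (R : ℝ) (e₁ e₂ : EuclideanSpace ℝ (Fin n)) (θ : ℝ) :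
    EuclideanSpace ℝ (Fin n) :=
  (R * Real.cos θ) • e₁ + (R * Real.sin θ) • e₂

/-- The `m`-th Fourier coefficient (not normalized) of the restriction of `U` to the circle. -/
def circleFourierCoeff {n : ℕ} (R : ℝ) (e₁ e₂ : EuclideanSpace ℝ (Fin n))
    (U : EuclideanSpace ℝ (Fin n) → ℂ) (m : ℤ) : ℂ :=
  ∫ θ in (0 : ℝ)..(2 * Real.pi),
    Complex.exp (-(Complex.I * (m : ℂ) * (θ : ℂ))) * U (circlePoint R e₁ e₂ θ)

/-- The Bessel function of the first kind of order `m ∈ ℕ`, by its power series. -/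
def besselJNat (m : ℕ) (x : ℝ) : ℝ :=
  ∑' s : ℕ, (-1 : ℝ) ^ s / ((s.factorial : ℝ) * ((s + m).factorial : ℝ)) * (x / 2) ^ (2 * s + m)

/-- The Bessel function of the first kind of integer order, with `J_{-k} = (-1)^k J_k`. -/
def besselJ (m : ℤ) (x : ℝ) : ℝ :=
  if 0 ≤ m then besselJNat m.natAbs x else (-1 : ℝ) ^ m.natAbs * besselJNat m.natAbs x

end

/-! Since `p` vanishes only on the spheres `|ξ| = r_j`, the equation `p 𝓕u = 0` confines `v = 𝓕 u`
to these spheres, which in the normalization `e^{-2πi x·ξ}` have radii `r_j / (2π)`. By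
Paley–Wiener–Schwartz, `u` is a smooth function, and its `m`-th coefficient on the circle is `v`
applied to `ξ ↦ ∫ e^{-imθ} e^{2πi x(θ)·ξ} dθ`, cut off away from the spheres. This test function is
`expFourierCoeff (A ξ) (B ξ) m` with `A`, `B` linear and `|A ξ|, |B ξ| ≤ πR|ξ|`.

The growth condition on `u` bounds `v` by weighted `L¹` norms of at most `d` derivatives
(`IsTemperedOfOrder.norm_fourier_apply_le`). Each derivative of the test function shifts `m` by one
and costs at most a factor `|m|`. A cutoff to an `O(1/|m|)` neighbourhood of the ball of radius `a =
r_max / (2π)` costs the same, and enlarges the `|m|`-th power of the radius only by a bounded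
factor. Hence the coefficient is `O(|m|^d (r_max R/2)^{|m|} / |m|!)`
(`exists_norm_apply_expFourierCoeff_le`).

For large `|m|`, the quotient `(r_max R/2)^{|m|} / |m|!` is at most `2 |J_m(r_max R)|`
(`half_le_besselJNat`), so the largest sphere alone accounts for the estimate. The finitely many
other `m` are absorbed in the constant: for `d ≥ 1` the right side is positive, because `J_m` and
`J_{m+1}` have no common positive zero. If `d = 0`, then `v` is bounded by the `L¹` norm and
supported in a null set, so `v = 0`. -/

/-! ### Bessel functions: leading term for large order, and common zeros -/

theorem summable_besselJNat (m : ℕ) (x : ℝ) :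
    Summable fun s : ℕ => (-1 : ℝ) ^ s / ((s.factorial : ℝ) * ((s + m).factorial : ℝ)) *
      (x / 2) ^ (2 * s + m) := by
  refine Summable.of_norm_bounded
    (g := fun s : ℕ => |x / 2| ^ m * (((x / 2) ^ 2) ^ s / (s.factorial : ℝ)))
    ((Real.summable_pow_div_factorial _).mul_left _) fun s => ?_
  have h1 : (1 : ℝ) ≤ (s + m).factorial := by exact_mod_cast (s + m).factorial_pos
  have h2 : (0 : ℝ) < s.factorial := by exact_mod_cast s.factorial_pos
  rw [norm_mul, norm_div, norm_pow, norm_neg, norm_one, one_pow, norm_mul, Real.norm_natCast,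
    Real.norm_natCast, norm_pow, Real.norm_eq_abs, pow_add, pow_mul, sq_abs]
  calc 1 / ((s.factorial : ℝ) * ((s + m).factorial : ℝ)) * (((x / 2) ^ 2) ^ s * |x / 2| ^ m)
      ≤ 1 / (s.factorial : ℝ) * (((x / 2) ^ 2) ^ s * |x / 2| ^ m) := by
        gcongr
        exact le_mul_of_one_le_right h2.le h1
    _ = _ := by ring

/-- Comparison of power series: the term `s + 1` on the right collects the term `s + 1` of `J_m` and
the term `s` of `J_{m+2}`; the term `0` comes from `J_m` alone. -/
theorem besselJNat_recurrence (m : ℕ) {x : ℝ} (hx : x ≠ 0) :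
    besselJNat m x + besselJNat (m + 2) x = 2 * (m + 1) / x * besselJNat (m + 1) x := by
  unfold besselJNat
  rw [← tsum_mul_left, (summable_besselJNat m x).tsum_eq_zero_add,
    (((summable_besselJNat (m + 1) x).mul_left _)).tsum_eq_zero_add, add_assoc,
    ← Summable.tsum_add ((summable_nat_add_iff 1).2 (summable_besselJNat m x))
      (summable_besselJNat (m + 2) x)]
  congr 1
  · simp only [pow_zero, Nat.factorial_zero, Nat.cast_one, one_mul, zero_add, mul_zero,
      Nat.factorial_succ, Nat.cast_mul, Nat.cast_add]
    have h2 : (0 : ℝ) < m.factorial := by exact_mod_cast m.factorial_pos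
    rw [pow_succ (x / 2) m]
    field_simp
  · refine tsum_congr fun s => ?_
    have e1 : (s + 1 + m).factorial = (s + m + 1) * (s + m).factorial := by
      rw [← Nat.factorial_succ]; congr 1; omega
    have e2 : (s + (m + 2)).factorial = (s + m + 2) * ((s + m + 1) * (s + m).factorial) := by
      rw [← Nat.factorial_succ, ← Nat.factorial_succ]; congr 1
    have e3 : (s + 1 + (m + 1)).factorial = (s + m + 2) * ((s + m + 1) * (s + m).factorial) := by
      rw [← e2]; congr 1; omega
    have e4 : (s + 1).factorial = (s + 1) * s.factorial := Nat.factorial_succ s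
    rw [e1, e2, e3, e4]
    have h1 : (0 : ℝ) < (s + m).factorial := by exact_mod_cast (s + m).factorial_pos
    have h2 : (0 : ℝ) < s.factorial := by exact_mod_cast s.factorial_pos
    have e5 : 2 * (s + 1) + (m + 1) = (2 * s + m + 2) + 1 := by ring
    have e6 : 2 * (s + 1) + m = 2 * s + m + 2 := by ring
    have e7 : 2 * s + (m + 2) = 2 * s + m + 2 := by ring
    rw [e5, e6, e7, pow_succ _ (2 * s + m + 2), pow_succ (-1 : ℝ) s]
    push_cast
    field_simp
    ring

/-- With `y = x / 2`, the terms after the first sum to at most `y ^ 2 * exp (y ^ 2) / (m + 1)` times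
the first one, and `hm` makes this factor at most `1/2`. -/
theorem half_le_besselJNat {m : ℕ} {x : ℝ} (hx : 0 ≤ x)
    (hm : 2 * ((x / 2) ^ 2 * Real.exp ((x / 2) ^ 2)) ≤ m + 1) :
    (x / 2) ^ m / m.factorial / 2 ≤ besselJNat m x := by
  unfold besselJNat
  set y := x / 2 with hy
  have hy0 : 0 ≤ y := by positivity
  rw [(summable_besselJNat m x).tsum_eq_zero_add]
  have hmf : (0 : ℝ) < m.factorial := by exact_mod_cast m.factorial_pos
  have hS : Summable fun s : ℕ => y ^ m / m.factorial * (y ^ 2 / (m + 1)) *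
      ((y ^ 2) ^ s / (s.factorial : ℝ)) := (Real.summable_pow_div_factorial _).mul_left _
  have key : ‖∑' s : ℕ, (-1 : ℝ) ^ (s + 1) / (((s + 1).factorial : ℝ) * ((s + 1 + m).factorial : ℝ)) *
      y ^ (2 * (s + 1) + m)‖ ≤ y ^ m / m.factorial / 2 := by
    refine (tsum_of_norm_bounded hS.hasSum fun s => ?_).trans ?_
    · have h2 : (0 : ℝ) < s.factorial := by exact_mod_cast s.factorial_pos
      have h3 : ((m : ℝ) + 1) * m.factorial ≤ (s + 1 + m).factorial := by
        have : (m + 1).factorial ≤ (s + 1 + m).factorial := Nat.factorial_le (by omega)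
        rw [Nat.factorial_succ] at this
        exact_mod_cast this
      have h4 : (s.factorial : ℝ) ≤ (s + 1).factorial := by
        exact_mod_cast Nat.factorial_le (by omega)
      rw [norm_mul, norm_div, norm_pow, norm_neg, norm_one, one_pow, norm_mul, Real.norm_natCast,
        Real.norm_natCast, norm_pow, Real.norm_of_nonneg hy0]
      calc 1 / (((s + 1).factorial : ℝ) * ((s + 1 + m).factorial : ℝ)) * y ^ (2 * (s + 1) + m)
          ≤ 1 / ((s.factorial : ℝ) * (((m : ℝ) + 1) * m.factorial)) * y ^ (2 * (s + 1) + m) := by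
            gcongr
        _ = _ := by
            rw [← pow_mul, show 2 * (s + 1) + m = m + 2 + 2 * s by ring, pow_add, pow_add]
            field_simp
    · rw [tsum_mul_left]
      have : ∑' s : ℕ, (y ^ 2) ^ s / (s.factorial : ℝ) = Real.exp (y ^ 2) := by
        rw [Real.exp_eq_exp_ℝ, NormedSpace.exp_eq_tsum_div]
      rw [this, mul_assoc, div_eq_mul_inv _ (2 : ℝ)]
      gcongr
      rw [div_mul_eq_mul_div, div_le_iff₀ (by positivity)]
      linarith
  have := (abs_le.1 key).1
  simp only [pow_zero, Nat.factorial_zero, Nat.cast_one, one_mul, zero_add, mul_zero] at this ⊢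
  have e : (1 : ℝ) / m.factorial * y ^ m = y ^ m / m.factorial := by ring
  rw [e]
  linarith

theorem exists_half_le_besselJNat {x : ℝ} (hx : 0 ≤ x) :
    ∃ M : ℕ, ∀ m : ℕ, M ≤ m → (x / 2) ^ m / m.factorial / 2 ≤ besselJNat m x := by
  obtain ⟨M, hM⟩ := exists_nat_ge (2 * ((x / 2) ^ 2 * Real.exp ((x / 2) ^ 2)))
  refine ⟨M, fun m hm => half_le_besselJNat hx ?_⟩
  have : (M : ℝ) ≤ m := by exact_mod_cast hm
  linarith

/-- Two consecutive zeros would propagate through the recurrence to all higher orders, against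
positivity for large order. -/
theorem besselJNat_ne_zero_or_succ_ne_zero (m : ℕ) {x : ℝ} (hx : 0 < x) :
    besselJNat m x ≠ 0 ∨ besselJNat (m + 1) x ≠ 0 := by
  by_contra! h
  have key : ∀ k, besselJNat (m + k) x = 0 ∧ besselJNat (m + k + 1) x = 0 := by
    intro k
    induction k with
    | zero => exact h
    | succ k ih =>
      refine ⟨ih.2, ?_⟩
      have := besselJNat_recurrence (m + k) hx.ne'
      rw [ih.1, ih.2] at this
      simp only [zero_add, mul_zero] at this
      exact this
  obtain ⟨M, hM⟩ := exists_half_le_besselJNat hx.le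
  have h1 := hM (m + M) (by omega)
  rw [(key M).1] at h1
  have : 0 < (x / 2) ^ (m + M) / (m + M).factorial / 2 := by positivity
  linarith

theorem abs_besselJ (m : ℤ) (x : ℝ) : |besselJ m x| = |besselJNat m.natAbs x| := by
  unfold besselJ
  split_ifs
  · rfl
  · rw [abs_mul, abs_pow, abs_neg, abs_one, one_pow, one_mul]

theorem abs_besselJ_add_pos (m : ℤ) {x : ℝ} (hx : 0 < x) :
    0 < |besselJ m x| + |besselJ (m + 1) x| := by
  rw [abs_besselJ, abs_besselJ]
  have h : besselJNat m.natAbs x ≠ 0 ∨ besselJNat (m + 1).natAbs x ≠ 0 := by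
    rcases le_or_gt 0 m with hm | hm
    · rw [show (m + 1).natAbs = m.natAbs + 1 by omega]
      exact besselJNat_ne_zero_or_succ_ne_zero _ hx
    · rw [show m.natAbs = (m + 1).natAbs + 1 by omega]
      exact (besselJNat_ne_zero_or_succ_ne_zero _ hx).symm
  rcases h with h | h
  · have := abs_pos.2 h
    positivity
  · have := abs_pos.2 h
    positivity

/-! ### Fourier coefficients of `exp (a e^{iθ} + b e^{-iθ})` -/

open Complex in
/-- The `m`-th Fourier coefficient (not normalized) of `exp (a e^{iθ} + b e^{-iθ})`. -/
noncomputable def expFourierCoeff (a b : ℂ) (m : ℤ) : ℂ :=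
  ∫ θ in (0 : ℝ)..(2 * Real.pi),
    exp (-(I * (m : ℂ) * (θ : ℂ))) * exp (a * exp (I * θ) + b * exp (-(I * θ)))

section
open Complex

theorem intervalIntegral_two_pi_sub (f : ℝ → ℂ) :
    ∫ θ in (0 : ℝ)..(2 * Real.pi), f (2 * Real.pi - θ) = ∫ θ in (0 : ℝ)..(2 * Real.pi), f θ := by
  rw [intervalIntegral.integral_comp_sub_left]
  simp

/-- Cauchy's theorem on the unit circle for the entire function `z ^ j * exp (b * z)`. -/
theorem integral_exp_pow_mul_exp_eq_zero (b : ℂ) (j : ℕ) :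
    ∫ θ in (0 : ℝ)..(2 * Real.pi),
      exp (I * θ) ^ (j + 1) * exp (b * exp (I * θ)) = 0 := by
  have h : DiffContOnCl ℂ (fun z : ℂ => z ^ j * exp (b * z)) (Metric.ball 0 1) :=
    (by fun_prop : Differentiable ℂ (fun z : ℂ => z ^ j * exp (b * z))).diffContOnCl
  have h0 := h.circleIntegral_eq_zero zero_le_one
  rw [circleIntegral] at h0
  have h1 : ∀ θ : ℝ, deriv (circleMap 0 1) θ • (circleMap 0 1 θ ^ j * exp (b * circleMap 0 1 θ))
      = I * (exp (I * θ) ^ (j + 1) * exp (b * exp (I * θ))) := by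
    intro θ
    simp only [deriv_circleMap, circleMap, ofReal_one, one_mul, zero_add, smul_eq_mul]
    rw [mul_comm (θ : ℂ) I, pow_succ]
    ring
  simp only [h1] at h0
  rw [intervalIntegral.integral_const_mul] at h0
  exact (mul_eq_zero.1 h0).resolve_left I_ne_zero

theorem exp_I_mul_two_pi_sub (θ : ℝ) : exp (I * ((2 * Real.pi - θ : ℝ) : ℂ)) = exp (-(I * θ)) := by
  rw [← exp_periodic (-(I * θ))]
  congr 1
  push_cast
  ring

theorem exp_neg_I_mul_two_pi_sub (θ : ℝ) :
    exp (-(I * ((2 * Real.pi - θ : ℝ) : ℂ))) = exp (I * θ) := by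
  rw [exp_neg, exp_I_mul_two_pi_sub, ← exp_neg, neg_neg]

theorem exp_neg_I_int_mul (m : ℤ) (θ : ℂ) : exp (-(I * m * θ)) = exp (-(I * θ)) ^ m := by
  rw [← exp_int_mul]
  congr 1
  ring

theorem expFourierCoeff_neg (a b : ℂ) (m : ℤ) :
    expFourierCoeff a b (-m) = expFourierCoeff b a m := by
  unfold expFourierCoeff
  rw [← intervalIntegral_two_pi_sub]
  refine intervalIntegral.integral_congr fun θ _ => ?_
  simp only [exp_neg_I_int_mul, exp_I_mul_two_pi_sub, exp_neg_I_mul_two_pi_sub]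
  rw [zpow_neg, exp_neg (I * θ), inv_zpow, add_comm]

theorem norm_exp_I_mul (θ : ℝ) : ‖exp (I * θ)‖ = 1 := by
  rw [mul_comm, norm_exp_ofReal_mul_I]

theorem norm_exp_neg_I_mul (θ : ℝ) : ‖exp (-(I * θ))‖ = 1 := by
  rw [exp_neg, norm_inv, norm_exp_I_mul, inv_one]

/-- The Taylor terms of degree `k < m` of `exp (a e^{iθ})`, multiplied by `e^{-imθ} exp (b
e^{-iθ})`, contain only negative frequencies and integrate to zero. What remains is a Taylor
remainder, which carries the decay `‖a‖ ^ m / m!`. -/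
theorem expFourierCoeff_natCast_eq (a b : ℂ) (m : ℕ) :
    expFourierCoeff a b m = ∫ θ in (0 : ℝ)..(2 * Real.pi), exp (-(I * θ)) ^ m *
      ((exp (a * exp (I * θ)) - ∑ k ∈ Finset.range m, (a * exp (I * θ)) ^ k / k.factorial) *
        exp (b * exp (-(I * θ)))) := by
  have hz : ∀ k ∈ Finset.range m, ∫ θ in (0 : ℝ)..(2 * Real.pi), exp (-(I * θ)) ^ m *
      ((a * exp (I * θ)) ^ k / k.factorial * exp (b * exp (-(I * θ)))) = 0 := by
    intro k hk
    obtain ⟨j, rfl⟩ : ∃ j, m = k + (j + 1) :=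
      ⟨m - k - 1, by have := Finset.mem_range.1 hk; omega⟩
    rw [← intervalIntegral_two_pi_sub]
    simp only [exp_I_mul_two_pi_sub, exp_neg_I_mul_two_pi_sub]
    calc _ = ∫ θ in (0 : ℝ)..(2 * Real.pi), (a ^ k / k.factorial) *
          (exp (I * θ) ^ (j + 1) * exp (b * exp (I * θ))) := by
          refine intervalIntegral.integral_congr fun θ _ => ?_
          have : exp (I * θ) ≠ 0 := exp_ne_zero _
          simp only [exp_neg (I * (θ : ℂ)), pow_add, mul_pow, inv_pow]
          field_simp
      _ = 0 := by rw [intervalIntegral.integral_const_mul, integral_exp_pow_mul_exp_eq_zero, mul_zero]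
  have hi : ∀ k ∈ Finset.range m, IntervalIntegrable (fun θ : ℝ => exp (-(I * θ)) ^ m *
      ((a * exp (I * θ)) ^ k / k.factorial * exp (b * exp (-(I * θ))))) MeasureTheory.volume
      0 (2 * Real.pi) := fun k _ => Continuous.intervalIntegrable (by fun_prop) _ _
  have hs := intervalIntegral.integral_finsetSum hi
  rw [Finset.sum_eq_zero hz] at hs
  have h1 : expFourierCoeff a b m = ∫ θ in (0 : ℝ)..(2 * Real.pi), exp (-(I * θ)) ^ m *
      (exp (a * exp (I * θ)) * exp (b * exp (-(I * θ)))) := by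
    refine intervalIntegral.integral_congr fun θ _ => ?_
    simp only [exp_neg_I_int_mul, exp_add, zpow_natCast]
  rw [h1, ← sub_zero (∫ θ in (0 : ℝ)..(2 * Real.pi), _), ← hs, ← intervalIntegral.integral_sub
    (Continuous.intervalIntegrable (by fun_prop) _ _)
    (Continuous.intervalIntegrable (by fun_prop) _ _)]
  refine intervalIntegral.integral_congr fun θ _ => ?_
  simp only [sub_mul, mul_sub, Finset.sum_mul, Finset.mul_sum]

theorem norm_expFourierCoeff_natCast_le {a b : ℂ} {m : ℕ} (hm : 2 * ‖a‖ ≤ m + 1) :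
    ‖expFourierCoeff a b m‖ ≤ 4 * Real.pi * Real.exp ‖b‖ * (‖a‖ ^ m / m.factorial) := by
  rw [expFourierCoeff_natCast_eq]
  refine (intervalIntegral.norm_integral_le_of_norm_le_const
    (C := ‖a‖ ^ m / m.factorial * 2 * Real.exp ‖b‖) fun θ _ => ?_).trans_eq ?_
  · rw [norm_mul, norm_pow, norm_exp_neg_I_mul, one_pow, one_mul, norm_mul]
    have ha : ‖a * exp (I * θ)‖ = ‖a‖ := by rw [norm_mul, norm_exp_I_mul, mul_one]
    gcongr
    · refine (exp_bound' ?_).trans_eq (by rw [ha])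
      rw [ha, div_le_iff₀ (by positivity)]
      push_cast
      linarith
    · refine (norm_exp_le_exp_norm _).trans_eq ?_
      rw [norm_mul, norm_exp_neg_I_mul, mul_one]
  · rw [sub_zero, abs_of_pos Real.two_pi_pos]
    ring

theorem norm_expFourierCoeff_le {a b : ℂ} {m : ℤ} {t : ℝ} (ha : ‖a‖ ≤ t) (hb : ‖b‖ ≤ t)
    (hm : 2 * t ≤ m.natAbs + 1) :
    ‖expFourierCoeff a b m‖ ≤ 4 * Real.pi * Real.exp t * (t ^ m.natAbs / m.natAbs.factorial) := by
  have key : ∀ (a b : ℂ) (k : ℕ), ‖a‖ ≤ t → ‖b‖ ≤ t → 2 * t ≤ k + 1 →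
      ‖expFourierCoeff a b k‖ ≤ 4 * Real.pi * Real.exp t * (t ^ k / k.factorial) := by
    intro a b k ha hb hk
    refine (norm_expFourierCoeff_natCast_le (by linarith)).trans ?_
    gcongr
  rcases Int.natAbs_eq m with h | h
  · conv_lhs => rw [h]
    exact key a b _ ha hb hm
  · conv_lhs => rw [h, expFourierCoeff_neg]
    exact key b a _ hb ha hm

variable {E : Type*} [NormedAddCommGroup E] [NormedSpace ℝ E]

/-- Differentiation under the integral brings down `e^{iθ} A + e^{-iθ} B`, and the factors `e^{±iθ}`
move the frequency by one. -/
theorem hasFDerivAt_expFourierCoeff (A B : E →L[ℝ] ℂ) (m : ℤ) (ξ : E) :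
    HasFDerivAt (fun ξ => expFourierCoeff (A ξ) (B ξ) m)
      (expFourierCoeff (A ξ) (B ξ) (m - 1) • A + expFourierCoeff (A ξ) (B ξ) (m + 1) • B) ξ := by
  let F : E → ℝ → ℂ := fun ξ θ =>
    exp (-(I * (m : ℂ) * (θ : ℂ))) * exp (A ξ * exp (I * θ) + B ξ * exp (-(I * θ)))
  let F' : E → ℝ → E →L[ℝ] ℂ := fun ξ θ =>
    (F ξ θ * exp (I * θ)) • A + (F ξ θ * exp (-(I * θ))) • B
  have hd : ∀ ξ θ, HasFDerivAt (F · θ) (F' ξ θ) ξ := by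
    intro ξ θ
    have h1 : HasFDerivAt (fun ξ => A ξ * exp (I * θ) + B ξ * exp (-(I * θ)))
        (exp (I * θ) • A + exp (-(I * θ)) • B) ξ :=
      (A.hasFDerivAt.mul_const _).add (B.hasFDerivAt.mul_const _)
    refine (h1.cexp.const_mul (exp (-(I * (m : ℂ) * (θ : ℂ))))).congr_fderiv ?_
    ext v
    simp [F', F]
    ring
  have hcont : ∀ ξ, Continuous (F ξ) := fun ξ => by fun_prop
  have hcont' : ∀ ξ, Continuous (F' ξ) := fun ξ => by fun_prop
  have hnF : ∀ ξ' ∈ Metric.ball ξ 1, ∀ θ : ℝ,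
      ‖F ξ' θ‖ ≤ Real.exp (‖A‖ * (‖ξ‖ + 1) + ‖B‖ * (‖ξ‖ + 1)) := by
    intro ξ' hξ' θ
    have h0 : ‖ξ'‖ ≤ ‖ξ‖ + 1 := by
      have := norm_le_norm_add_norm_sub' ξ' ξ
      rw [mem_ball_iff_norm] at hξ'
      linarith
    have h1 : ‖exp (-(I * (m : ℂ) * (θ : ℂ)))‖ = 1 := by
      rw [exp_neg_I_int_mul, norm_zpow, norm_exp_neg_I_mul, one_zpow]
    simp only [F]
    rw [norm_mul, h1, one_mul]
    refine (norm_exp_le_exp_norm _).trans (Real.exp_le_exp.2 ((norm_add_le _ _).trans ?_))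
    rw [norm_mul, norm_mul, norm_exp_I_mul, norm_exp_neg_I_mul, mul_one, mul_one]
    exact add_le_add ((A.le_opNorm _).trans (by gcongr)) ((B.le_opNorm _).trans (by gcongr))
  have h := intervalIntegral.hasFDerivAt_integral_of_dominated_of_fderiv_le (𝕜 := ℝ)
    (μ := MeasureTheory.volume) (F := F)
    (F' := F') (a := 0) (b := 2 * Real.pi) (x₀ := ξ)
    (bound := fun _ => Real.exp (‖A‖ * (‖ξ‖ + 1) + ‖B‖ * (‖ξ‖ + 1)) * ‖A‖ +
      Real.exp (‖A‖ * (‖ξ‖ + 1) + ‖B‖ * (‖ξ‖ + 1)) * ‖B‖) (Metric.ball_mem_nhds ξ one_pos)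
    (Filter.Eventually.of_forall fun ξ' => (hcont ξ').aestronglyMeasurable)
    ((hcont ξ).intervalIntegrable _ _)
    (hcont' ξ).aestronglyMeasurable
    (Filter.Eventually.of_forall fun θ _ ξ' hξ' => ?_)
    (Continuous.intervalIntegrable (by fun_prop) _ _)
    (Filter.Eventually.of_forall fun θ _ ξ' _ => hd ξ' θ)
  · refine h.congr_fderiv ?_
    have e1 : ∀ θ : ℝ, F ξ θ * exp (I * θ) = exp (-(I * ((m - 1 : ℤ) : ℂ) * (θ : ℂ))) *
        exp (A ξ * exp (I * θ) + B ξ * exp (-(I * θ))) := by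
      intro θ
      simp only [F]
      rw [mul_right_comm, ← exp_add]
      congr 2
      push_cast
      ring
    have e2 : ∀ θ : ℝ, F ξ θ * exp (-(I * θ)) = exp (-(I * ((m + 1 : ℤ) : ℂ) * (θ : ℂ))) *
        exp (A ξ * exp (I * θ) + B ξ * exp (-(I * θ))) := by
      intro θ
      simp only [F]
      rw [mul_right_comm, ← exp_add]
      congr 2
      push_cast
      ring
    simp only [F', e1, e2]
    rw [intervalIntegral.integral_add (Continuous.intervalIntegrable (by fun_prop) _ _)
      (Continuous.intervalIntegrable (by fun_prop) _ _), intervalIntegral.integral_smul_const,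
      intervalIntegral.integral_smul_const]
    rfl
  · simp only [F']
    refine (norm_add_le _ _).trans ?_
    rw [norm_smul, norm_smul, norm_mul (F ξ' θ), norm_mul (F ξ' θ), norm_exp_I_mul, norm_exp_neg_I_mul, mul_one]
    have := hnF ξ' hξ' θ
    gcongr

theorem fderiv_expFourierCoeff (A B : E →L[ℝ] ℂ) (m : ℤ) :
    fderiv ℝ (fun ξ => expFourierCoeff (A ξ) (B ξ) m) = fun ξ =>
      expFourierCoeff (A ξ) (B ξ) (m - 1) • A + expFourierCoeff (A ξ) (B ξ) (m + 1) • B :=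
  funext fun ξ => (hasFDerivAt_expFourierCoeff A B m ξ).fderiv

theorem contDiff_expFourierCoeff (A B : E →L[ℝ] ℂ) (m : ℤ) :
    ContDiff ℝ ∞ (fun ξ => expFourierCoeff (A ξ) (B ξ) m) := by
  refine contDiff_infty.2 fun n => ?_
  induction n generalizing m with
  | zero =>
    exact contDiff_zero.2 (continuous_iff_continuousAt.2 fun ξ =>
      (hasFDerivAt_expFourierCoeff A B m ξ).continuousAt)
  | succ n ih =>
    rw [Nat.cast_succ]
    refine contDiff_succ_iff_fderiv.2 ⟨fun ξ =>
      (hasFDerivAt_expFourierCoeff A B m ξ).differentiableAt, by simp, ?_⟩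
    rw [fderiv_expFourierCoeff]
    exact ((ih _).smul contDiff_const).add ((ih _).smul contDiff_const)

theorem norm_iteratedFDeriv_smul_const_le {f : E → ℂ} (hf : ContDiff ℝ ∞ f) (A : E →L[ℝ] ℂ)
    (l : ℕ) (ξ : E) :
    ‖iteratedFDeriv ℝ l (fun ξ => f ξ • A) ξ‖ ≤ ‖A‖ * ‖iteratedFDeriv ℝ l f ξ‖ := by
  let L : ℂ →L[ℝ] E →L[ℝ] ℂ := (ContinuousLinearMap.lsmul ℝ ℂ).flip A
  have hL : ‖L‖ ≤ ‖A‖ := L.opNorm_le_bound (norm_nonneg _) fun c => by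
    simp [L, norm_smul, mul_comm]
  refine (L.norm_iteratedFDeriv_comp_left (N := ∞) (f := f) (x := ξ) hf.contDiffAt
    (n := l) (by exact_mod_cast le_top)).trans ?_
  gcongr

/-- Passing from order `k` to `k - 1` multiplies `t ^ k / k!` by `k / t`, and passing to `k + 1`
multiplies it by `t / (k + 1)`: either way at most one factor `k` is lost, uniformly for `t` in
`[t₀, t₁]`. -/
theorem pow_mul_pow_div_factorial_shift_le {t₀ t₁ t : ℝ} (ht₀ : 0 < t₀) (h₀ : t₀ ≤ t)
    (h₁ : t ≤ t₁) (l : ℕ) {k j : ℕ} (hk : 1 ≤ k) (hj : j + 1 = k ∨ j = k + 1) :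
    (j : ℝ) ^ l * (t ^ j / j.factorial) ≤
      2 ^ l * (t₀⁻¹ + t₁) * ((k : ℝ) ^ (l + 1) * (t ^ k / k.factorial)) := by
  have ht : 0 < t := ht₀.trans_le h₀
  have ht₁ : 0 < t₁ := ht.trans_le h₁
  have hk' : (1 : ℝ) ≤ k := by exact_mod_cast hk
  rcases hj with rfl | rfl
  · have hjf : (0 : ℝ) < j.factorial := by exact_mod_cast j.factorial_pos
    calc (j : ℝ) ^ l * (t ^ j / j.factorial)
        = 1 * t⁻¹ * ((j : ℝ) ^ l * (j + 1) * (t ^ (j + 1) / (j + 1).factorial)) := by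
          rw [Nat.factorial_succ, pow_succ t]
          push_cast
          field_simp
      _ ≤ 2 ^ l * (t₀⁻¹ + t₁) * (((j + 1 : ℕ) : ℝ) ^ (l + 1) *
            (t ^ (j + 1) / (j + 1).factorial)) := by
          gcongr
          · exact one_le_pow₀ one_le_two
          · calc t⁻¹ ≤ t₀⁻¹ := by gcongr
              _ ≤ t₀⁻¹ + t₁ := by linarith
          · rw [pow_succ]
            push_cast
            gcongr
            linarith
  · have hjf : (0 : ℝ) < k.factorial := by exact_mod_cast k.factorial_pos
    calc ((k + 1 : ℕ) : ℝ) ^ l * (t ^ (k + 1) / (k + 1).factorial)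
        = ((k + 1 : ℕ) : ℝ) ^ l * (t / (k + 1)) * (t ^ k / k.factorial) := by
          rw [Nat.factorial_succ, pow_succ t]
          push_cast
          field_simp
      _ ≤ (2 * k) ^ l * (t₀⁻¹ + t₁) * (t ^ k / k.factorial) := by
          gcongr
          · push_cast
            linarith
          · calc t / ((k : ℝ) + 1) ≤ t := div_le_self ht.le (by linarith)
              _ ≤ t₀⁻¹ + t₁ := by have := inv_pos.2 ht₀; linarith
      _ = 2 ^ l * (t₀⁻¹ + t₁) * (k ^ l * 1 * (t ^ k / k.factorial)) := by
          rw [mul_pow]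
          ring
      _ ≤ _ := by
          rw [pow_succ]
          gcongr

/-- The derivatives of `ξ ↦ expFourierCoeff (A ξ) (B ξ) m` lose at most one factor `|m|` each. -/
theorem norm_iteratedFDeriv_expFourierCoeff_le (A B : E →L[ℝ] ℂ) {t₀ t₁ : ℝ} (ht₀ : 0 < t₀)
    (l : ℕ) : ∃ C : ℝ, 0 ≤ C ∧ ∃ M : ℕ, ∀ t ∈ Set.Icc t₀ t₁, ∀ m : ℤ, M ≤ m.natAbs →
      ∀ ξ, ‖A ξ‖ ≤ t → ‖B ξ‖ ≤ t → ‖iteratedFDeriv ℝ l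
        (fun ξ => expFourierCoeff (A ξ) (B ξ) m) ξ‖ ≤
          C * ((m.natAbs : ℝ) ^ l * (t ^ m.natAbs / m.natAbs.factorial)) := by
  induction l with
  | zero =>
    obtain ⟨M, hM⟩ := exists_nat_ge (2 * t₁)
    refine ⟨4 * Real.pi * Real.exp t₁, by positivity, M, fun t ht m hm ξ ha hb => ?_⟩
    have hm' : (M : ℝ) ≤ m.natAbs := by exact_mod_cast hm
    have ht0 : 0 < t := ht₀.trans_le ht.1
    rw [norm_iteratedFDeriv_zero, pow_zero, one_mul]
    refine (norm_expFourierCoeff_le ha hb (by linarith [ht.2])).trans ?_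
    gcongr
    exact ht.2
  | succ l ih =>
    obtain ⟨C, hC, M, h⟩ := ih
    -- The threshold `M + 1` ensures `|m| ≥ 1` and `|m ± 1| ≥ M`, so that the induction hypothesis
    -- covers both shifted orders.
    refine ⟨‖A‖ * (C * (2 ^ l * (t₀⁻¹ + |t₁|))) + ‖B‖ * (C * (2 ^ l * (t₀⁻¹ + |t₁|))),
      by positivity, M + 1, fun t ht m hm ξ ha hb => ?_⟩
    have step : ∀ m' : ℤ, m' = m - 1 ∨ m' = m + 1 → ‖iteratedFDeriv ℝ l
        (fun ξ => expFourierCoeff (A ξ) (B ξ) m') ξ‖ ≤ C * (2 ^ l * (t₀⁻¹ + |t₁|)) *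
          ((m.natAbs : ℝ) ^ (l + 1) * (t ^ m.natAbs / m.natAbs.factorial)) := by
      intro m' hm'
      have h1 : 1 ≤ m.natAbs := by omega
      have h2 : m'.natAbs + 1 = m.natAbs ∨ m'.natAbs = m.natAbs + 1 := by omega
      refine (h t ht m' (by omega) ξ ha hb).trans ?_
      exact (mul_le_mul_of_nonneg_left (pow_mul_pow_div_factorial_shift_le ht₀ ht.1
        (ht.2.trans (le_abs_self _)) l h1 h2) hC).trans_eq (by ring)
    rw [← norm_iteratedFDeriv_fderiv, fderiv_expFourierCoeff]
    have hs := contDiff_expFourierCoeff A B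
    have hadd := iteratedFDeriv_add_apply (𝕜 := ℝ) (i := l) (x := ξ)
      (f := fun ξ => expFourierCoeff (A ξ) (B ξ) (m - 1) • A)
      (g := fun ξ => expFourierCoeff (A ξ) (B ξ) (m + 1) • B)
      (((hs _).smul contDiff_const).of_le (by exact_mod_cast le_top)).contDiffAt
      (((hs _).smul contDiff_const).of_le (by exact_mod_cast le_top)).contDiffAt
    refine (congrArg norm hadd).trans_le ((norm_add_le _ _).trans ?_)
    rw [add_mul, mul_assoc ‖A‖, mul_assoc ‖B‖]
    refine add_le_add ((norm_iteratedFDeriv_smul_const_le (hs _) A l ξ).trans ?_)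
      ((norm_iteratedFDeriv_smul_const_le (hs _) B l ξ).trans ?_)
    · gcongr
      exact step _ (Or.inl rfl)
    · gcongr
      exact step _ (Or.inr rfl)
end

/-! ### Supports of tempered distributions -/

section
open Distribution
theorem exists_norm_iteratedFDeriv_le_of_hasCompactSupport {E : Type*}
    [NormedAddCommGroup E] [NormedSpace ℝ E] {χ : E → ℂ} (h : ContDiff ℝ ∞ χ)
    (hc : HasCompactSupport χ) (i : ℕ) : ∃ C : ℝ, 0 ≤ C ∧ ∀ ξ, ‖iteratedFDeriv ℝ i χ ξ‖ ≤ C := by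
  obtain ⟨C, hC⟩ := (h.continuous_iteratedFDeriv (m := i)
    (by exact_mod_cast le_top)).bounded_above_of_compact_support (hc.iteratedFDeriv i)
  exact ⟨C, (norm_nonneg _).trans (hC 0), hC⟩

variable {E : Type*} [NormedAddCommGroup E] [InnerProductSpace ℝ E]

/-- The quotient `ψ / p` is again a test function, and `v ψ = (p v) (ψ / p)`. -/
theorem Distribution.eq_zero_of_smulLeftCLM_eq_zero {v : 𝓢'(E, ℂ)} {p : E → ℂ}
    (hp : p.HasTemperateGrowth) (hv : TemperedDistribution.smulLeftCLM ℂ p v = 0)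
    {ψ : 𝓢(E, ℂ)} (hc : HasCompactSupport ψ) (h0 : ∀ ξ ∈ tsupport ψ, p ξ ≠ 0) : v ψ = 0 := by
  have hs : ContDiff ℝ ∞ fun ξ => ψ ξ / p ξ := by
    refine contDiff_iff_contDiffAt.2 fun ξ => ?_
    by_cases hξ : ξ ∈ tsupport ψ
    · simp only [div_eq_mul_inv]
      exact (ψ.smooth ⊤).contDiffAt.mul (hp.1.contDiffAt.inv (h0 ξ hξ))
    · refine (contDiffAt_const (c := 0)).congr_of_eventuallyEq ?_
      filter_upwards [notMem_tsupport_iff_eventuallyEq.1 hξ] with x hx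
      rw [hx, Pi.zero_apply, zero_div]
  have hc' : HasCompactSupport fun ξ => ψ ξ / p ξ := by
    simp only [div_eq_mul_inv]
    exact hc.mul_right
  have h1 : SchwartzMap.smulLeftCLM ℂ p (hc'.toSchwartzMap hs) = ψ := by
    ext ξ
    rw [SchwartzMap.smulLeftCLM_apply_apply hp, HasCompactSupport.toSchwartzMap_toFun, smul_eq_mul]
    by_cases hξ : ξ ∈ tsupport ψ
    · exact mul_div_cancel₀ _ (h0 ξ hξ)
    · rw [image_eq_zero_of_notMem_tsupport hξ, zero_div, mul_zero]
  rw [← h1, ← TemperedDistribution.smulLeftCLM_apply_apply, hv]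
  rfl

theorem Distribution.IsVanishingOn.eq_of_eqOn {v : 𝓢'(E, ℂ)} {S U : Set E}
    (hv : IsVanishingOn v Sᶜ) (hU : IsOpen U) (hSU : S ⊆ U) {ψ₁ ψ₂ : 𝓢(E, ℂ)}
    (h : Set.EqOn ψ₁ ψ₂ U) : v ψ₁ = v ψ₂ := by
  rw [← sub_eq_zero, ← map_sub]
  refine hv _ fun ξ hξ hS => ?_
  have hsub : Function.support (⇑(ψ₁ - ψ₂) : E → ℂ) ⊆ Uᶜ := fun x hx hxU => hx (by
    simp [h hxU])
  exact closure_minimal hsub hU.isClosed_compl hξ (hSU hS)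

variable [FiniteDimensional ℝ E]

theorem exists_contDiff_hasCompactSupport_eq_one (a : ℝ) :
    ∃ χ : E → ℂ, ContDiff ℝ ∞ χ ∧ HasCompactSupport χ ∧ ∀ ξ, ‖ξ‖ ≤ a → χ ξ = 1 := by
  let f : ContDiffBump (0 : E) := ⟨max a 1, max a 1 + 1, by positivity, by linarith⟩
  refine ⟨fun ξ => (f ξ : ℂ), Complex.ofRealCLM.contDiff.comp f.contDiff,
    f.hasCompactSupport.comp_left (g := fun x : ℝ => (x : ℂ)) Complex.ofReal_zero, fun ξ hξ => ?_⟩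
  have h : f ξ = 1 := f.one_of_mem_closedBall
    (mem_closedBall_zero_iff.2 (hξ.trans (le_max_left _ _)))
  simp only [h, Complex.ofReal_one]

/-- The multipliers are dilated cutoffs `χ (ξ / (k + 1))`. Their difference from `1` lives on `‖ξ‖ ≥
k + 1`, where one extra power of `‖ξ‖` in the seminorm gains a factor `1 / (k + 1)`. -/
theorem SchwartzMap.exists_tendsto_hasCompactSupport (ψ : 𝓢(E, ℂ)) :
    ∃ h : ℕ → E → ℂ, (∀ k, ContDiff ℝ ∞ (h k)) ∧ (∀ k, HasCompactSupport (h k)) ∧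
      Filter.Tendsto (fun k => SchwartzMap.smulLeftCLM ℂ (h k) ψ) Filter.atTop (nhds ψ) := by
  obtain ⟨χ, hχ, hχc, hχ1⟩ := exists_contDiff_hasCompactSupport_eq_one (E := E) 1
  choose C hC0 hC using exists_norm_iteratedFDeriv_le_of_hasCompactSupport hχ hχc
  let h : ℕ → E → ℂ := fun k ξ => χ (((k : ℝ) + 1)⁻¹ • ξ)
  have hh : ∀ k, ContDiff ℝ ∞ (h k) := fun k => hχ.comp (contDiff_const_smul _)
  have hhc : ∀ k, HasCompactSupport (h k) := fun k =>
    hχc.comp_smul (inv_ne_zero (by positivity))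
  refine ⟨h, hh, hhc, ?_⟩
  rw [(schwartz_withSeminorms ℂ E ℂ).tendsto_nhds]
  rintro ⟨a, n⟩ ε hε
  let K : ℝ := ∑ i ∈ Finset.range (n + 1),
    (n.choose i : ℝ) * (C i + 1) * SchwartzMap.seminorm ℂ (a + 1) (n - i) ψ
  have hK : 0 ≤ K := Finset.sum_nonneg fun i _ => by have := hC0 i; positivity
  obtain ⟨k₀, hk₀⟩ := exists_nat_gt (K / ε)
  filter_upwards [Filter.eventually_ge_atTop k₀] with k hk
  have hkk : (k₀ : ℝ) ≤ k := by exact_mod_cast hk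
  have hk1 : (0 : ℝ) < (k : ℝ) + 1 := by positivity
  have hlt : K * ((k : ℝ) + 1)⁻¹ < ε := by
    rw [mul_inv_lt_iff₀ hk1]
    rw [div_lt_iff₀ hε] at hk₀
    nlinarith
  refine lt_of_le_of_lt ?_ hlt
  refine SchwartzMap.seminorm_le_bound _ _ _ _ (by positivity) fun x => ?_
  have htg : (h k).HasTemperateGrowth := (hhc k).hasTemperateGrowth (hh k)
  have he : (⇑(SchwartzMap.smulLeftCLM ℂ (h k) ψ - ψ) : E → ℂ) = fun y => (h k y - 1) * ψ y := by
    ext y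
    simp [SchwartzMap.smulLeftCLM_apply_apply htg, sub_mul]
  rw [he]
  rcases lt_or_ge ‖x‖ ((k : ℝ) + 1) with hx | hx
  · have h0 : (fun y => (h k y - 1) * ψ y) =ᶠ[nhds x] fun _ => 0 := by
      filter_upwards [(isOpen_lt continuous_norm continuous_const).mem_nhds hx] with y hy
      have hy' : ‖y‖ < (k : ℝ) + 1 := hy
      simp only [h]
      rw [hχ1, sub_self, zero_mul]
      rw [norm_smul, Real.norm_of_nonneg (by positivity), inv_mul_le_iff₀ hk1]
      linarith
    rw [(h0.iteratedFDeriv ℝ n).eq_of_nhds]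
    have : iteratedFDeriv ℝ n (fun _ : E => (0 : ℂ)) x = 0 := by
      simp
    rw [this, norm_zero, mul_zero]
    positivity
  · have hb : ∀ i, ‖iteratedFDeriv ℝ i (fun y => h k y - 1) x‖ ≤ C i + 1 := by
      intro i
      have h1 : ‖iteratedFDeriv ℝ i (h k) x‖ ≤ C i := by
        simp only [h]
        rw [iteratedFDeriv_comp_const_smul _ (hχ.of_le (by exact_mod_cast le_top)), norm_smul,
          norm_pow, Real.norm_of_nonneg (by positivity)]
        refine (mul_le_of_le_one_left (norm_nonneg _) ?_).trans (hC i _)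
        exact pow_le_one₀ (by positivity) (inv_le_one_of_one_le₀ (by linarith [k.cast_nonneg (α := ℝ)]))
      have h2 : ‖iteratedFDeriv ℝ i (fun _ : E => (1 : ℂ)) x‖ ≤ 1 := by
        rcases Nat.eq_zero_or_pos i with rfl | hi
        · simp
        · rw [iteratedFDeriv_const_of_ne hi.ne']
          simp
      have h3 := iteratedFDeriv_sub_apply (𝕜 := ℝ) (i := i) (x := x) (f := h k)
        (g := fun _ : E => (1 : ℂ))
        ((hh k).of_le (by exact_mod_cast le_top)).contDiffAt contDiff_const.contDiffAt
      refine (congrArg norm h3).trans_le ((norm_sub_le _ _).trans (add_le_add h1 h2))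
    have hm := norm_iteratedFDeriv_mul_le (n := n) (N := ∞) ((hh k).sub contDiff_const) (ψ.smooth ⊤)
      x (g := ψ) (f := fun y => h k y - 1) (by exact_mod_cast le_top)
    calc ‖x‖ ^ a * ‖iteratedFDeriv ℝ n (fun y => (h k y - 1) * ψ y) x‖
        ≤ ‖x‖ ^ a * (‖x‖ * ((k : ℝ) + 1)⁻¹) * ∑ i ∈ Finset.range (n + 1), (n.choose i : ℝ) *
          (C i + 1) * ‖iteratedFDeriv ℝ (n - i) ψ x‖ := by
          rw [mul_assoc]
          gcongr
          refine (hm.trans (Finset.sum_le_sum fun i _ => ?_)).trans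
            (le_mul_of_one_le_left (Finset.sum_nonneg fun i _ => ?_) ?_)
          · have := hb i
            gcongr
          · have := hC0 i
            positivity
          · rw [← div_eq_mul_inv, one_le_div hk1]
            exact hx
      _ = (∑ i ∈ Finset.range (n + 1), (n.choose i : ℝ) * (C i + 1) *
            (‖x‖ ^ (a + 1) * ‖iteratedFDeriv ℝ (n - i) ψ x‖)) * ((k : ℝ) + 1)⁻¹ := by
          rw [Finset.mul_sum, Finset.sum_mul]
          refine Finset.sum_congr rfl fun i _ => by ring
      _ ≤ K * ((k : ℝ) + 1)⁻¹ := by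
          refine mul_le_mul_of_nonneg_right (Finset.sum_le_sum fun i _ => ?_) (by positivity)
          have := hC0 i
          gcongr
          exact ψ.le_seminorm ℂ (a + 1) (n - i) x

/-- `IsVanishingOn` also tests Schwartz functions with noncompact support in `s`; these are limits
of compactly supported ones with no larger support. -/
theorem isVanishingOn_of_forall_hasCompactSupport {v : 𝓢'(E, ℂ)} {s : Set E}
    (hv : ∀ ψ : 𝓢(E, ℂ), HasCompactSupport ψ → tsupport ψ ⊆ s → v ψ = 0) :
    IsVanishingOn v s := by
  intro ψ hψ
  obtain ⟨h, hh, hhc, hlim⟩ := ψ.exists_tendsto_hasCompactSupport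
  have h0 : ∀ k, v (SchwartzMap.smulLeftCLM ℂ (h k) ψ) = 0 := by
    intro k
    have htg : (h k).HasTemperateGrowth := (hhc k).hasTemperateGrowth (hh k)
    refine hv _ ?_ ?_
    · rw [SchwartzMap.smulLeftCLM_apply htg]
      exact (hhc k).smul_right
    · exact (SchwartzMap.tsupport_smulLeftCLM_subset _ _).trans (Set.inter_subset_left.trans hψ)
  have := ((map_continuous v).tendsto ψ).comp hlim
  exact tendsto_nhds_unique this (by simp [Function.comp_def, h0])

end

/-! ### Distributions with compactly supported Fourier transform are functions -/

section
open Distribution MeasureTheory FourierTransform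
variable {E : Type*} [NormedAddCommGroup E] [InnerProductSpace ℝ E] [FiniteDimensional ℝ E]
  [MeasurableSpace E] [BorelSpace E]

theorem SchwartzMap.integrable_one_add_norm_pow_mul_norm (φ : 𝓢(E, ℂ)) (k : ℕ) :
    Integrable fun x => (1 + ‖x‖) ^ k * ‖φ x‖ := by
  have h : Integrable fun x => 2 ^ (k - 1) * (‖φ x‖ + ‖x‖ ^ k * ‖φ x‖) :=
    (φ.integrable.norm.add (φ.integrable_pow_mul volume k)).const_mul _
  refine h.mono' (by fun_prop) (Filter.Eventually.of_forall fun x => ?_)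
  rw [Real.norm_of_nonneg (by positivity)]
  calc (1 + ‖x‖) ^ k * ‖φ x‖ ≤ (2 ^ (k - 1) * (1 ^ k + ‖x‖ ^ k)) * ‖φ x‖ := by
        gcongr
        exact add_pow_le zero_le_one (norm_nonneg _) k
    _ = _ := by rw [one_pow]; ring

theorem SchwartzMap.norm_iteratedFDeriv_fourierInv_le (φ : 𝓢(E, ℂ)) (j : ℕ) (ξ : E) :
    ‖iteratedFDeriv ℝ j (𝓕⁻ φ : 𝓢(E, ℂ)) ξ‖ ≤
      (2 * Real.pi) ^ j * (j + 1) * ∫ x, (1 + ‖x‖) ^ j * ‖φ x‖ := by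
  let φ' : 𝓢(E, ℂ) :=
    SchwartzMap.compCLMOfContinuousLinearEquiv ℂ (LinearIsometryEquiv.neg ℝ (E := E)) φ
  have hφ' : ∀ x, φ' x = φ (-x) := fun x => rfl
  have h0 : ((𝓕⁻ φ : 𝓢(E, ℂ)) : E → ℂ) = 𝓕 (φ' : E → ℂ) := by
    rw [SchwartzMap.fourierInv_coe, Real.fourierInv_eq_fourier_comp_neg]
    rfl
  rw [h0]
  have h1 := Real.pow_mul_norm_iteratedFDeriv_fourier_le (f := φ') (K := ⊤) (N := ⊤)
    (φ'.smooth ⊤) (fun k n _ _ => φ'.integrable_pow_mul_iteratedFDeriv volume k n)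
    (k := j) (n := 0) le_top le_top ξ
  rw [pow_zero, one_mul, pow_zero, mul_one] at h1
  refine h1.trans ?_
  rw [mul_assoc]
  gcongr
  have h2 : ∀ i ∈ Finset.range (j + 1) ×ˢ Finset.range (0 + 1),
      ∫ x, ‖x‖ ^ i.1 * ‖iteratedFDeriv ℝ i.2 φ' x‖ ≤ ∫ x, (1 + ‖x‖) ^ j * ‖φ x‖ := by
    rintro ⟨i, l⟩ hi
    simp only [Finset.mem_product, Finset.mem_range] at hi
    obtain rfl : l = 0 := by omega
    simp only [norm_iteratedFDeriv_zero, hφ']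
    calc ∫ x, ‖x‖ ^ i * ‖φ (-x)‖ = ∫ x, ‖-x‖ ^ i * ‖φ (-x)‖ := by simp only [norm_neg]
      _ = ∫ x, ‖x‖ ^ i * ‖φ x‖ := integral_neg_eq_self (fun x => ‖x‖ ^ i * ‖φ x‖) volume
      _ ≤ ∫ x, (1 + ‖x‖) ^ j * ‖φ x‖ := by
        refine integral_mono (φ.integrable_pow_mul volume i)
          (φ.integrable_one_add_norm_pow_mul_norm j) fun x => ?_
        have : ‖x‖ ^ i ≤ (1 + ‖x‖) ^ j :=
          (pow_le_pow_left₀ (norm_nonneg _) (by linarith) i).trans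
            (pow_le_pow_right₀ (by linarith [norm_nonneg x]) (by omega))
        simp only
        gcongr
  refine (Finset.sum_le_card_nsmul _ _ _ h2).trans_eq ?_
  simp

/-- Cut off on the Fourier side, a tempered distribution is bounded by weighted `L¹` norms. -/
theorem exists_norm_smulLeftCLM_fourierInv_le (v : 𝓢'(E, ℂ)) {χ : E → ℂ} (hχ : ContDiff ℝ ∞ χ)
    (hχc : HasCompactSupport χ) : ∃ (C : ℝ) (M : ℕ), 0 ≤ C ∧ ∀ φ : 𝓢(E, ℂ),
      ‖v (SchwartzMap.smulLeftCLM ℂ χ (𝓕⁻ φ))‖ ≤ C * ∫ x, (1 + ‖x‖) ^ M * ‖φ x‖ := by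
  have htg : χ.HasTemperateGrowth := hχc.hasTemperateGrowth hχ
  obtain ⟨s, C, -, hC⟩ := Seminorm.bound_of_continuous (schwartz_withSeminorms ℂ E ℂ)
    ((normSeminorm ℂ ℂ).comp (v : 𝓢(E, ℂ) →ₗ[ℂ] ℂ)) (continuous_norm.comp (map_continuous v))
  let X : 𝓢(E, ℂ) := hχc.toSchwartzMap hχ
  have hX : (X : E → ℂ) = χ := rfl
  let M : ℕ := s.sup Prod.snd
  let K : ℕ × ℕ → ℝ := fun p => ∑ i ∈ Finset.range (p.2 + 1), (p.2.choose i : ℝ) *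
    SchwartzMap.seminorm ℂ p.1 i X * ((2 * Real.pi) ^ (p.2 - i) * ((p.2 - i : ℕ) + 1))
  have hK : ∀ p, 0 ≤ K p := fun p => Finset.sum_nonneg fun i _ => by positivity
  have hbound : ∀ p ∈ s, ∀ φ : 𝓢(E, ℂ), SchwartzMap.seminorm ℂ p.1 p.2
      (SchwartzMap.smulLeftCLM ℂ χ (𝓕⁻ φ)) ≤ K p * ∫ x, (1 + ‖x‖) ^ M * ‖φ x‖ := by
    rintro ⟨k, n⟩ hp φ
    have hnM : n ≤ M := Finset.le_sup (f := Prod.snd) hp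
    have hI : 0 ≤ ∫ x, (1 + ‖x‖) ^ M * ‖φ x‖ := integral_nonneg fun x => by positivity
    refine SchwartzMap.seminorm_le_bound _ _ _ _ (mul_nonneg (hK _) hI) fun ξ => ?_
    have he : ((SchwartzMap.smulLeftCLM ℂ χ (𝓕⁻ φ : 𝓢(E, ℂ)) : 𝓢(E, ℂ)) : E → ℂ) =
        fun ξ => X ξ * (𝓕⁻ φ : 𝓢(E, ℂ)) ξ := by
      rw [SchwartzMap.smulLeftCLM_apply htg]
      rfl
    rw [he]
    have hm := norm_iteratedFDeriv_mul_le (n := n) (N := ∞) (X.smooth ⊤)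
      ((𝓕⁻ φ : 𝓢(E, ℂ)).smooth ⊤) ξ (by exact_mod_cast le_top)
    refine (mul_le_mul_of_nonneg_left hm (by positivity)).trans ?_
    rw [Finset.mul_sum, Finset.sum_mul]
    refine Finset.sum_le_sum fun i hi => ?_
    have h1 := (𝓕⁻ φ : 𝓢(E, ℂ)).norm_iteratedFDeriv_le_seminorm ℂ (n - i) ξ
    have h2 : ‖iteratedFDeriv ℝ (n - i) (𝓕⁻ φ : 𝓢(E, ℂ)) ξ‖ ≤
        (2 * Real.pi) ^ (n - i) * ((n - i : ℕ) + 1) * ∫ x, (1 + ‖x‖) ^ M * ‖φ x‖ := by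
      refine (φ.norm_iteratedFDeriv_fourierInv_le (n - i) ξ).trans ?_
      refine mul_le_mul_of_nonneg_left (integral_mono (φ.integrable_one_add_norm_pow_mul_norm _)
        (φ.integrable_one_add_norm_pow_mul_norm _) fun x => ?_) (by positivity)
      simp only
      gcongr
      · linarith [norm_nonneg x]
      · omega
    have h3 := X.le_seminorm ℂ k i ξ
    calc ‖ξ‖ ^ k * ((n.choose i : ℝ) * ‖iteratedFDeriv ℝ i X ξ‖ *
          ‖iteratedFDeriv ℝ (n - i) (𝓕⁻ φ : 𝓢(E, ℂ)) ξ‖)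
        = (n.choose i : ℝ) * (‖ξ‖ ^ k * ‖iteratedFDeriv ℝ i X ξ‖) *
          ‖iteratedFDeriv ℝ (n - i) (𝓕⁻ φ : 𝓢(E, ℂ)) ξ‖ := by ring
      _ ≤ (n.choose i : ℝ) * SchwartzMap.seminorm ℂ k i X *
          ((2 * Real.pi) ^ (n - i) * ((n - i : ℕ) + 1) * ∫ x, (1 + ‖x‖) ^ M * ‖φ x‖) := by
          gcongr
      _ = _ := by ring
  refine ⟨C * ∑ p ∈ s, K p, M, mul_nonneg C.2 (Finset.sum_nonneg fun p _ => hK p), fun φ => ?_⟩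
  have h1 := hC (SchwartzMap.smulLeftCLM ℂ χ (𝓕⁻ φ))
  have h2 := (Seminorm.finset_sup_le_sum (schwartzSeminormFamily ℂ E ℂ) s)
    (SchwartzMap.smulLeftCLM ℂ χ (𝓕⁻ φ))
  refine h1.trans ?_
  rw [smul_apply, mul_assoc, NNReal.smul_def, smul_eq_mul]
  refine mul_le_mul_of_nonneg_left (h2.trans ?_) C.2
  rw [sum_apply, Finset.sum_mul]
  exact Finset.sum_le_sum fun p hp => hbound p hp φ

/-- A functional on Schwartz functions bounded by a weighted `L¹` norm is the integral against a
function of polynomial growth in the mean. -/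
theorem exists_eq_integral_mul_of_norm_le (u : 𝓢'(E, ℂ)) {C : ℝ} {M : ℕ}
    (hu : ∀ φ : 𝓢(E, ℂ), ‖u φ‖ ≤ C * ∫ x, (1 + ‖x‖) ^ M * ‖φ x‖) :
    ∃ (f : E → ℂ) (K : ℕ), Integrable (fun x => ((1 + ‖x‖) ^ K)⁻¹ • f x) ∧
      ∀ φ : 𝓢(E, ℂ), u φ = ∫ x, f x * φ x := by
  obtain ⟨D, hD⟩ := Measure.HasTemperateGrowth.exists_eLpNorm_lt_top 2
    (inferInstance : (volume : Measure E).HasTemperateGrowth)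
  let G : E → ℝ := fun x => (1 + ‖x‖) ^ (-(D : ℝ))
  have hGc : Continuous G := by
    refine Continuous.rpow_const (by fun_prop) fun x => Or.inl ?_
    positivity
  have hG0 : ∀ x, 0 ≤ G x := fun x => by positivity
  have hG : MemLp G 2 volume := ⟨hGc.aestronglyMeasurable, hD⟩
  -- `D` makes `(1 + ‖x‖) ^ (-D)` square integrable. Since `1 + ‖x‖ ≤ 2 * (1 + ‖x‖ ^ 2)`, the weight
  -- `(1 + ‖x‖ ^ 2) ^ (-s)` absorbs `(1 + ‖x‖) ^ M` and leaves that function as a factor.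
  let s : ℕ := M + D
  let w : ℝ → E → ℂ := fun r x => (((1 + ‖x‖ ^ 2) ^ r : ℝ) : ℂ)
  have hw : ∀ r, (w r).HasTemperateGrowth := fun r => by
    simp only [w]
    fun_prop
  let W : ℝ → 𝓢(E, ℂ) →L[ℂ] 𝓢(E, ℂ) := fun r => SchwartzMap.smulLeftCLM ℂ (w r)
  have hW : ∀ r (φ : 𝓢(E, ℂ)) x, W r φ x = w r x * φ x := fun r φ x =>
    SchwartzMap.smulLeftCLM_apply_apply (hw r) φ x
  have hWW : ∀ φ, W (-s) (W s φ) = φ := by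
    intro φ
    ext x
    have h0 : (0 : ℝ) < 1 + ‖x‖ ^ 2 := by positivity
    rw [hW, hW, ← mul_assoc]
    simp only [w]
    rw [← Complex.ofReal_mul, ← Real.rpow_add h0, neg_add_cancel, Real.rpow_zero,
      Complex.ofReal_one, one_mul]
  let l : 𝓢(E, ℂ) →ₗ[ℂ] ℂ := (u : 𝓢(E, ℂ) →ₗ[ℂ] ℂ) ∘ₗ (W (-s) : 𝓢(E, ℂ) →ₗ[ℂ] 𝓢(E, ℂ))
  let e : 𝓢(E, ℂ) →ₗ[ℂ] Lp ℂ 2 (volume : Measure E) :=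
    (SchwartzMap.toLpCLM ℂ ℂ 2 (volume : Measure E)).toLinearMap
  have hde : DenseRange e := by
    have := SchwartzMap.denseRange_toLpCLM (F := ℂ) (E := E) (p := 2) (μ := volume) (by simp)
    exact this
  have hlb : ∃ C', ∀ φ, ‖l φ‖ ≤ C' * ‖e φ‖ := by
    refine ⟨|C| * (2 ^ s * (∫ x, G x ^ (2 : ℝ)) ^ (1 / (2 : ℝ))), fun φ => ?_⟩
    have h1 : ∀ x, (1 + ‖x‖) ^ M * ‖W (-s) φ x‖ ≤ 2 ^ s * (G x * ‖φ x‖) := by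
      intro x
      have h0 : (0 : ℝ) < 1 + ‖x‖ ^ 2 := by positivity
      have h2 : (0 : ℝ) < 1 + ‖x‖ := by positivity
      have h3 : (1 + ‖x‖) ^ s ≤ (2 * (1 + ‖x‖ ^ 2)) ^ s := by
        gcongr
        nlinarith [sq_nonneg (‖x‖ - 1), sq_nonneg ‖x‖]
      rw [hW, norm_mul, Complex.norm_real, Real.norm_of_nonneg (by positivity), ← mul_assoc,
        ← mul_assoc]
      refine mul_le_mul_of_nonneg_right ?_ (norm_nonneg _)
      simp only [G]
      rw [Real.rpow_neg h0.le, Real.rpow_neg h2.le, Real.rpow_natCast, Real.rpow_natCast,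
        ← div_eq_mul_inv, ← div_eq_mul_inv, div_le_div_iff₀ (by positivity) (by positivity),
        ← pow_add, ← mul_pow]
      exact h3
    have h2 : ∫ x, G x * ‖φ x‖ ≤ (∫ x, G x ^ (2 : ℝ)) ^ (1 / (2 : ℝ)) *
        (∫ x, ‖φ x‖ ^ (2 : ℝ)) ^ (1 / (2 : ℝ)) := by
      refine integral_mul_le_Lp_mul_Lq_of_nonneg Real.HolderConjugate.two_two
        (Filter.Eventually.of_forall hG0) (Filter.Eventually.of_forall fun x => norm_nonneg _) ?_ ?_
      · rw [ENNReal.ofReal_ofNat]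
        exact hG
      · rw [ENNReal.ofReal_ofNat]
        exact (φ.memLp 2 volume).norm
    have h3 : ‖e φ‖ = (∫ x, ‖φ x‖ ^ (2 : ℝ)) ^ (1 / (2 : ℝ)) := by
      have := SchwartzMap.norm_toLp' (f := φ) (p := 2) (μ := volume) (by simp) (by simp)
      have h4 : ‖e φ‖ = ‖φ.toLp 2 volume‖ := rfl
      rw [h4, this]
      simp
    have hint : Integrable fun x => 2 ^ s * (G x * ‖φ x‖) :=
      (hG.integrable_mul (φ.memLp 2 volume).norm).const_mul _
    calc ‖l φ‖ ≤ C * ∫ x, (1 + ‖x‖) ^ M * ‖W (-s) φ x‖ := hu _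
      _ ≤ |C| * ∫ x, 2 ^ s * (G x * ‖φ x‖) := by
        refine (mul_le_mul_of_nonneg_right (le_abs_self C)
          (integral_nonneg fun x => by positivity)).trans ?_
        exact mul_le_mul_of_nonneg_left (integral_mono
          ((W (-s) φ).integrable_one_add_norm_pow_mul_norm M) hint h1) (abs_nonneg C)
      _ ≤ _ := by
        rw [integral_const_mul, h3, mul_assoc |C|, mul_assoc (2 ^ s)]
        gcongr
  -- By Cauchy–Schwarz the weighted functional `l` is `L²`-bounded on a dense subspace; it extends
  -- to `L²`, and the Riesz representation yields the density `h`.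
  let T := l.extendOfNorm e
  have hT : ∀ φ, T (e φ) = l φ := l.extendOfNorm_eq hde hlb
  let h := (InnerProductSpace.toDual ℂ (Lp ℂ 2 (volume : Measure E))).symm T
  have hh : ∀ φ, inner ℂ h (e φ) = l φ := fun φ => by
    rw [← hT, InnerProductSpace.toDual_symm_apply]
  have hhm : MemLp (fun x => ‖h x‖) 2 volume := (Lp.memLp h).norm
  -- Removing the weight multiplies `h` by at most `(1 + ‖x‖) ^ (2 * s)`; the other `D` powers leave
  -- `‖h‖ * G`, a product of two `L²` functions.
  refine ⟨fun x => (starRingEnd ℂ) (h x) * w s x, 2 * s + D, ?_, fun φ => ?_⟩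
  · refine (hhm.integrable_mul hG).mono' ?_ (Filter.Eventually.of_forall fun x => ?_)
    · have h1 : AEStronglyMeasurable (fun x => (starRingEnd ℂ) (h x)) volume :=
        (Complex.continuous_conj.comp_aestronglyMeasurable (Lp.aestronglyMeasurable h))
      have h2 : Continuous fun x : E => ((1 + ‖x‖) ^ (2 * s + D))⁻¹ :=
        Continuous.inv₀ (by fun_prop) fun x => by positivity
      exact h2.aestronglyMeasurable.smul (h1.mul (hw s).1.continuous.aestronglyMeasurable)
    · have h0 : (0 : ℝ) < 1 + ‖x‖ ^ 2 := by positivity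
      have h2 : (0 : ℝ) < 1 + ‖x‖ := by positivity
      have h3 : (1 + ‖x‖ ^ 2) ^ s ≤ ((1 + ‖x‖) ^ 2) ^ s := by
        gcongr
        nlinarith [norm_nonneg x]
      rw [norm_smul, norm_mul, RCLike.norm_conj, Complex.norm_real,
        Real.norm_of_nonneg (by positivity), Real.norm_of_nonneg (by positivity)]
      simp only [G, Pi.mul_apply]
      rw [Real.rpow_neg h2.le, Real.rpow_natCast, Real.rpow_natCast, mul_left_comm]
      gcongr
      rw [pow_add, pow_mul, mul_inv, mul_right_comm, inv_mul_eq_div]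
      exact mul_le_of_le_one_left (by positivity) (div_le_one_of_le₀ h3 (by positivity))
  · have h1 : u φ = l (W s φ) := by
      change u φ = u (W (-s) (W s φ))
      rw [hWW]
    rw [h1, ← hh, L2.inner_def]
    refine integral_congr_ae ?_
    filter_upwards [(W s φ).coeFn_toLp 2 volume] with x hx
    have : (e (W s φ) : E → ℂ) x = W s φ x := hx
    rw [this, hW, RCLike.inner_apply']
    ring
end

/-! ### The smooth representative and its averages -/

section
open Distribution MeasureTheory FourierTransform
theorem one_add_norm_pow_le_mul {E : Type*} [NormedAddCommGroup E] (x y : E) (K : ℕ) :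
    (1 + ‖y‖) ^ K ≤ (1 + ‖y - x‖) ^ K * (1 + ‖x‖) ^ K := by
  rw [← mul_pow]
  gcongr
  have := norm_le_norm_add_norm_sub' y x
  nlinarith [norm_nonneg (y - x), norm_nonneg x]

variable {E : Type*} [NormedAddCommGroup E] [InnerProductSpace ℝ E]

theorem SchwartzMap.exists_norm_le_inv_one_add_norm_pow {F : Type*} [NormedAddCommGroup F]
    [NormedSpace ℝ F] (κ : 𝓢(E, F)) (K : ℕ) : ∃ C : ℝ, 0 ≤ C ∧ ∀ x y : E,
      ‖κ (y - x)‖ ≤ C * (1 + ‖x‖) ^ K * ((1 + ‖y‖) ^ K)⁻¹ := by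
  have h := fun z => κ.one_add_le_sup_seminorm_apply (𝕜 := ℝ) (m := (K, 0)) (k := K) (n := 0)
    le_rfl le_rfl z
  simp only [norm_iteratedFDeriv_zero] at h
  set C := 2 ^ K * ((Finset.Iic (K, 0)).sup fun m => SchwartzMap.seminorm ℝ m.1 m.2) κ
  refine ⟨C, by positivity, fun x y => ?_⟩
  rw [← div_eq_mul_inv, le_div_iff₀ (by positivity)]
  calc ‖κ (y - x)‖ * (1 + ‖y‖) ^ K
      ≤ ‖κ (y - x)‖ * ((1 + ‖y - x‖) ^ K * (1 + ‖x‖) ^ K) := by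
        gcongr
        exact one_add_norm_pow_le_mul x y K
    _ = ((1 + ‖y - x‖) ^ K * ‖κ (y - x)‖) * (1 + ‖x‖) ^ K := by ring
    _ ≤ C * (1 + ‖x‖) ^ K := by
        gcongr
        exact h _

variable [MeasurableSpace E] [BorelSpace E] [FiniteDimensional ℝ E]

theorem aestronglyMeasurable_of_weighted {f : E → ℂ} {K : ℕ}
    (hf : Integrable fun x => ((1 + ‖x‖) ^ K)⁻¹ • f x) : AEStronglyMeasurable f volume := by
  have h : f = fun x => ((1 + ‖x‖) ^ K) • (((1 + ‖x‖) ^ K)⁻¹ • f x) := by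
    ext x
    rw [smul_inv_smul₀ (by positivity)]
  rw [h]
  exact (by fun_prop : Continuous fun x : E => (1 + ‖x‖) ^ K).aestronglyMeasurable.smul
    hf.aestronglyMeasurable

/-- Fubini. The decay of `κ (y - X t)` is traded for decay in `y` and growth in `X t` through `1 +
‖y‖ ≤ (1 + ‖y - x‖) * (1 + ‖x‖)`, which is why `c` is weighted by `(1 + ‖X t‖) ^ K`. -/
theorem integral_mul_integral_shift {T : Type*} [MeasurableSpace T] (ν : Measure T) [SFinite ν]
    {X : T → E} (hX : Measurable X) {c : T → ℂ} (hc : AEStronglyMeasurable c ν) {K : ℕ}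
    (hcX : Integrable (fun t => (1 + ‖X t‖) ^ K * ‖c t‖) ν) {f : E → ℂ}
    (hf : Integrable fun x => ((1 + ‖x‖) ^ K)⁻¹ • f x) (κ : 𝓢(E, ℂ)) :
    ∫ t, c t * (∫ y, f y * κ (y - X t)) ∂ν = ∫ y, f y * (∫ t, c t * κ (y - X t) ∂ν) := by
  obtain ⟨C, hC0, hC⟩ := κ.exists_norm_le_inv_one_add_norm_pow K
  have hi : Integrable (Function.uncurry fun t y => c t * (f y * κ (y - X t)))
      (ν.prod volume) := by
    refine ((hcX.mul_prod hf.norm).const_mul C).mono' ?_ (Filter.Eventually.of_forall ?_)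
    · have hκ : Measurable fun z : T × E => κ (z.2 - X z.1) :=
        κ.continuous.measurable.comp (measurable_snd.sub (hX.comp measurable_fst))
      exact hc.comp_fst.mul
        ((aestronglyMeasurable_of_weighted hf).comp_snd.mul hκ.aestronglyMeasurable)
    · rintro ⟨t, y⟩
      simp only [Function.uncurry]
      rw [norm_mul, norm_mul, norm_smul, Real.norm_of_nonneg (by positivity)]
      calc ‖c t‖ * (‖f y‖ * ‖κ (y - X t)‖)
          ≤ ‖c t‖ * (‖f y‖ * (C * (1 + ‖X t‖) ^ K * ((1 + ‖y‖) ^ K)⁻¹)) := by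
            gcongr
            exact hC _ _
        _ = _ := by ring
  calc ∫ t, c t * (∫ y, f y * κ (y - X t)) ∂ν = ∫ t, (∫ y, c t * (f y * κ (y - X t))) ∂ν := by
        simp only [integral_const_mul]
    _ = ∫ y, ∫ t, c t * (f y * κ (y - X t)) ∂ν := integral_integral_swap hi
    _ = _ := by
        refine integral_congr_ae (Filter.Eventually.of_forall fun y => ?_)
        simp only
        rw [← integral_const_mul]
        refine integral_congr_ae (Filter.Eventually.of_forall fun t => ?_)
        simp only
        ring

/-- Multiplication by the character `e^{2πi X·ξ}` translates the Fourier transform by `X`. -/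
theorem SchwartzMap.fourier_eq_integral_shift {T : Type*} [MeasurableSpace T] (ν : Measure T)
    [SFinite ν] {X : T → E} (hX : Measurable X) {c : T → ℂ} (hc : Integrable c ν) (χ Ψ : 𝓢(E, ℂ))
    (hΨ : ∀ ξ, Ψ ξ = χ ξ * ∫ t, c t * Complex.exp ((2 * Real.pi * inner ℝ (X t) ξ : ℝ) *
      Complex.I) ∂ν) (y : E) :
    (𝓕 Ψ : 𝓢(E, ℂ)) y = ∫ t, c t * (𝓕 χ : 𝓢(E, ℂ)) (y - X t) ∂ν := by
  rw [SchwartzMap.fourier_coe, SchwartzMap.fourier_coe, Real.fourier_eq']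
  simp only [Real.fourier_eq', smul_eq_mul, hΨ]
  have hi : Integrable (Function.uncurry fun (t : T) (ξ : E) =>
      c t * (Complex.exp ((-2 * Real.pi * inner ℝ ξ (y - X t) : ℝ) * Complex.I) * χ ξ))
      (ν.prod volume) := by
    refine (hc.norm.mul_prod χ.integrable.norm).mono' ?_ (Filter.Eventually.of_forall ?_)
    · have h1 : Measurable fun z : T × E => Complex.exp
          ((-2 * Real.pi * inner ℝ z.2 (y - X z.1) : ℝ) * Complex.I) := by
        have : Measurable fun z : T × E => inner ℝ z.2 (y - X z.1) :=
          measurable_snd.inner (measurable_const.sub (hX.comp measurable_fst))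
        fun_prop
      exact hc.aestronglyMeasurable.comp_fst.mul (h1.aestronglyMeasurable.mul
        χ.continuous.aestronglyMeasurable.comp_snd)
    · rintro ⟨t, ξ⟩
      simp only [Function.uncurry]
      rw [norm_mul, norm_mul, Complex.norm_exp_ofReal_mul_I, one_mul]
  calc _ = ∫ ξ, ∫ t, c t * (Complex.exp ((-2 * Real.pi * inner ℝ ξ (y - X t) : ℝ) * Complex.I) *
          χ ξ) ∂ν := by
        refine integral_congr_ae (Filter.Eventually.of_forall fun ξ => ?_)
        simp only
        rw [← mul_assoc, ← integral_const_mul]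
        refine integral_congr_ae (Filter.Eventually.of_forall fun t => ?_)
        simp only
        have he : Complex.exp ((-2 * Real.pi * inner ℝ ξ (y - X t) : ℝ) * Complex.I) =
            Complex.exp ((-2 * Real.pi * inner ℝ ξ y : ℝ) * Complex.I) *
              Complex.exp ((2 * Real.pi * inner ℝ (X t) ξ : ℝ) * Complex.I) := by
          rw [← Complex.exp_add, inner_sub_right, real_inner_comm ξ (X t)]
          congr 1
          push_cast
          ring
        rw [he]
        ring
    _ = ∫ t, (∫ ξ, c t * (Complex.exp ((-2 * Real.pi * inner ℝ ξ (y - X t) : ℝ) *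
          Complex.I) * χ ξ)) ∂ν := (integral_integral_swap hi).symm
    _ = _ := by simp only [integral_const_mul]

theorem hasFDerivAt_integral_shift {f : E → ℂ} {K : ℕ}
    (hf : Integrable fun x => ((1 + ‖x‖) ^ K)⁻¹ • f x) (κ : 𝓢(E, ℂ)) (x : E) :
    Integrable (fun y => -(f y • fderiv ℝ κ (y - x))) ∧
    HasFDerivAt (fun x => ∫ y, f y * κ (y - x)) (∫ y, -(f y • fderiv ℝ κ (y - x))) x := by
  let κ' : 𝓢(E, E →L[ℝ] ℂ) := SchwartzMap.fderivCLM ℝ E ℂ κ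
  have hκ' : ∀ z, κ' z = fderiv ℝ κ z := fun z => rfl
  obtain ⟨C, hC0, hC⟩ := κ.exists_norm_le_inv_one_add_norm_pow K
  obtain ⟨C', hC0', hC'⟩ := κ'.exists_norm_le_inv_one_add_norm_pow K
  have hfm := aestronglyMeasurable_of_weighted hf
  have hm : ∀ x, AEStronglyMeasurable (fun y => f y * κ (y - x)) volume := fun x =>
    hfm.mul (κ.continuous.comp (by fun_prop)).aestronglyMeasurable
  have hm' : ∀ x, AEStronglyMeasurable (fun y => -(f y • fderiv ℝ κ (y - x))) volume := fun x =>
    (hfm.smul (κ'.continuous.comp (by fun_prop : Continuous fun y => y - x)).aestronglyMeasurable).neg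
  have hb : ∀ x₁ ∈ Metric.ball x 1, ∀ y, ‖-(f y • fderiv ℝ κ (y - x₁))‖ ≤
      C' * (2 + ‖x‖) ^ K * ‖((1 + ‖y‖) ^ K)⁻¹ • f y‖ := by
    intro x₁ hx₁ y
    have h0 : 1 + ‖x₁‖ ≤ 2 + ‖x‖ := by
      have := norm_le_norm_add_norm_sub' x₁ x
      rw [mem_ball_iff_norm] at hx₁
      linarith
    rw [norm_neg, norm_smul, norm_smul, Real.norm_of_nonneg (by positivity), ← hκ']
    calc ‖f y‖ * ‖κ' (y - x₁)‖ ≤ ‖f y‖ * (C' * (1 + ‖x₁‖) ^ K * ((1 + ‖y‖) ^ K)⁻¹) := by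
          gcongr
          exact hC' _ _
      _ ≤ ‖f y‖ * (C' * (2 + ‖x‖) ^ K * ((1 + ‖y‖) ^ K)⁻¹) := by gcongr
      _ = _ := by ring
  have hbi : Integrable fun y => C' * (2 + ‖x‖) ^ K * ‖((1 + ‖y‖) ^ K)⁻¹ • f y‖ :=
    hf.norm.const_mul _
  refine ⟨hbi.mono' (hm' x) (Filter.Eventually.of_forall (hb x (Metric.mem_ball_self one_pos))), ?_⟩
  refine hasFDerivAt_integral_of_dominated_of_fderiv_le (𝕜 := ℝ)
    (F' := fun x y => -(f y • fderiv ℝ κ (y - x))) (Metric.ball_mem_nhds x one_pos)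
    (Filter.Eventually.of_forall hm) ?_ (hm' x)
    (Filter.Eventually.of_forall fun y x₁ hx₁ => hb x₁ hx₁ y) hbi
    (Filter.Eventually.of_forall fun y x₁ _ => ?_)
  · refine (hf.norm.const_mul (C * (1 + ‖x‖) ^ K)).mono' (hm x)
      (Filter.Eventually.of_forall fun y => ?_)
    rw [norm_mul, norm_smul, Real.norm_of_nonneg (by positivity)]
    calc ‖f y‖ * ‖κ (y - x)‖ ≤ ‖f y‖ * (C * (1 + ‖x‖) ^ K * ((1 + ‖y‖) ^ K)⁻¹) := by
          gcongr
          exact hC _ _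
      _ = _ := by ring
  · have h1 : HasFDerivAt (fun x => y - x) (-ContinuousLinearMap.id ℝ E) x₁ :=
      (hasFDerivAt_id x₁).const_sub y
    refine (((κ.hasFDerivAt (y - x₁)).comp x₁ h1).const_mul (f y)).congr_fderiv ?_
    ext v
    simp

/-- A directional derivative replaces `κ` by minus its own directional derivative, again a Schwartz
function, so the induction runs over all `κ` at once. -/
theorem contDiff_integral_shift {f : E → ℂ} {K : ℕ}
    (hf : Integrable fun x => ((1 + ‖x‖) ^ K)⁻¹ • f x) (κ : 𝓢(E, ℂ)) :
    ContDiff ℝ ∞ fun x => ∫ y, f y * κ (y - x) := by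
  refine contDiff_infty.2 fun n => ?_
  induction n generalizing κ with
  | zero =>
    exact contDiff_zero.2 (continuous_iff_continuousAt.2 fun x =>
      (hasFDerivAt_integral_shift hf κ x).2.continuousAt)
  | succ n ih =>
    rw [Nat.cast_succ]
    refine contDiff_succ_iff_fderiv_apply.2 ⟨fun x =>
      (hasFDerivAt_integral_shift hf κ x).2.differentiableAt, by simp, fun v => ?_⟩
    have h : (fun x => fderiv ℝ (fun x => ∫ y, f y * κ (y - x)) x v) =
        fun x => -∫ y, f y * (SchwartzMap.evalCLM ℝ E ℂ v (SchwartzMap.fderivCLM ℝ E ℂ κ)) (y - x) := by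
      ext x
      obtain ⟨h1, h2⟩ := hasFDerivAt_integral_shift hf κ x
      rw [h2.fderiv, ContinuousLinearMap.integral_apply h1, ← integral_neg]
      rfl
    rw [h]
    exact (ih _).neg

/-- Bundled form of the Paley–Wiener–Schwartz theorem: a tempered distribution whose Fourier
transform is supported where the cutoff `χ` is `1` is a smooth function, and averages of this
function are computed by pairing the Fourier transform with superpositions of characters. -/
theorem exists_contDiff_integral_eq (u : 𝓢'(E, ℂ)) {χ : E → ℂ} (hχ : ContDiff ℝ ∞ χ)
    (hχc : HasCompactSupport χ) (hu : ∀ ψ : 𝓢(E, ℂ), 𝓕 u (SchwartzMap.smulLeftCLM ℂ χ ψ) = 𝓕 u ψ) :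
    ∃ (U : E → ℂ) (K : ℕ), ContDiff ℝ ∞ U ∧ ∀ {T : Type} [MeasurableSpace T] (ν : Measure T)
      [SFinite ν] {X : T → E} (_ : Measurable X) {c : T → ℂ} (_ : Integrable c ν)
      (_ : Integrable (fun t => (1 + ‖X t‖) ^ K * ‖c t‖) ν) (Ψ : 𝓢(E, ℂ))
      (_ : ∀ ξ, Ψ ξ = χ ξ * ∫ t, c t * Complex.exp ((2 * Real.pi * inner ℝ (X t) ξ : ℝ) *
        Complex.I) ∂ν), ∫ t, c t * U (X t) ∂ν = 𝓕 u Ψ := by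
  obtain ⟨C, M, -, hC⟩ := exists_norm_smulLeftCLM_fourierInv_le (𝓕 u) hχ hχc
  have hb : ∀ φ : 𝓢(E, ℂ), ‖u φ‖ ≤ C * ∫ x, (1 + ‖x‖) ^ M * ‖φ x‖ := by
    intro φ
    have := hC φ
    rwa [hu, TemperedDistribution.fourier_apply, fourier_fourierInv_eq] at this
  obtain ⟨f, K, hf, hfu⟩ := exists_eq_integral_mul_of_norm_le u hb
  let X' : 𝓢(E, ℂ) := hχc.toSchwartzMap hχ
  -- This is `𝓕 u` tested on `χ` times the character `e^{2πi x·ξ}`.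
  refine ⟨fun x => ∫ y, f y * (𝓕 X' : 𝓢(E, ℂ)) (y - x), K, contDiff_integral_shift hf _, ?_⟩
  intro T _ ν _ X hX c hc hcX Ψ hΨ
  rw [integral_mul_integral_shift ν hX hc.aestronglyMeasurable hcX hf,
    TemperedDistribution.fourier_apply, hfu]
  simp only [SchwartzMap.fourier_eq_integral_shift ν hX hc X' Ψ hΨ]
end

/-! ### Cutoffs at scale `1/k` and estimates near the support -/

section
open Distribution MeasureTheory FourierTransform

/-- A smooth step function, equal to `1` on `(-∞, 1/2]` and to `0` on `[1, ∞)`. -/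
noncomputable def smoothStep (t : ℝ) : ℂ := (Real.smoothTransition (2 - 2 * t) : ℂ)

theorem contDiff_smoothStep : ContDiff ℝ ∞ smoothStep :=
  Complex.ofRealCLM.contDiff.comp (Real.smoothTransition.contDiff.comp (by fun_prop))

theorem smoothStep_of_le {t : ℝ} (ht : t ≤ 1 / 2) : smoothStep t = 1 := by
  rw [smoothStep, Real.smoothTransition.one_of_one_le (by linarith), Complex.ofReal_one]

theorem smoothStep_of_ge {t : ℝ} (ht : 1 ≤ t) : smoothStep t = 0 := by
  rw [smoothStep, Real.smoothTransition.zero_of_nonpos (by linarith), Complex.ofReal_zero]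

theorem norm_smoothStep_le (t : ℝ) : ‖smoothStep t‖ ≤ 1 := by
  rw [smoothStep, Complex.norm_real, Real.norm_of_nonneg (Real.smoothTransition.nonneg _)]
  exact Real.smoothTransition.le_one _

theorem hasCompactSupport_fderiv_smoothStep : HasCompactSupport (fderiv ℝ smoothStep) := by
  refine HasCompactSupport.intro (isCompact_Icc (a := 1 / 2) (b := 1)) fun t ht => ?_
  rw [Set.mem_Icc, not_and_or, not_le, not_le] at ht
  rcases ht with ht | ht
  · have : smoothStep =ᶠ[nhds t] fun _ => 1 := by
      filter_upwards [Iio_mem_nhds ht] with s hs using smoothStep_of_le (le_of_lt hs)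
    rw [this.fderiv_eq, fderiv_fun_const, Pi.zero_apply]
  · have : smoothStep =ᶠ[nhds t] fun _ => 0 := by
      filter_upwards [Ioi_mem_nhds ht] with s hs using smoothStep_of_ge (le_of_lt hs)
    rw [this.fderiv_eq, fderiv_fun_const, Pi.zero_apply]

theorem exists_norm_iteratedFDeriv_smoothStep_le (j : ℕ) :
    ∃ C : ℝ, 0 ≤ C ∧ ∀ t, ‖iteratedFDeriv ℝ j smoothStep t‖ ≤ C := by
  cases j with
  | zero => exact ⟨1, zero_le_one, fun t => by
      rw [norm_iteratedFDeriv_zero]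
      exact norm_smoothStep_le t⟩
  | succ j =>
    have h : ContDiff ℝ ∞ (fderiv ℝ smoothStep) :=
      contDiff_smoothStep.fderiv_right (by simp)
    obtain ⟨C, hC⟩ := (h.continuous_iteratedFDeriv (m := j)
      (by exact_mod_cast le_top)).bounded_above_of_compact_support
      (hasCompactSupport_fderiv_smoothStep.iteratedFDeriv j)
    refine ⟨C, (norm_nonneg _).trans (hC 0), fun t => ?_⟩
    rw [← norm_iteratedFDeriv_fderiv]
    exact hC t

variable {E : Type*} [NormedAddCommGroup E] [InnerProductSpace ℝ E] [FiniteDimensional ℝ E]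

/-- Rescaling the argument of a smooth step function by `k` costs a factor `k` per derivative,
locally uniformly. -/
theorem exists_norm_iteratedFDeriv_smoothStep_comp_le {q : E → ℝ} (hq : ContDiff ℝ ∞ q) (b : ℝ)
    (j : ℕ) : ∃ C : ℝ, 0 ≤ C ∧ ∀ k : ℕ, 1 ≤ k → ∀ ξ, ‖ξ‖ ≤ b →
      ‖iteratedFDeriv ℝ j (fun ξ => smoothStep (k * q ξ)) ξ‖ ≤ C * (k : ℝ) ^ j := by
  choose S hS0 hS using exists_norm_iteratedFDeriv_smoothStep_le
  have hQ : ∀ i : ℕ, ∃ Q, ∀ ξ ∈ Metric.closedBall (0 : E) b, ‖iteratedFDeriv ℝ i q ξ‖ ≤ Q :=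
    fun i => (isCompact_closedBall 0 b).exists_bound_of_continuousOn
      (hq.continuous_iteratedFDeriv (m := i) (by exact_mod_cast le_top)).continuousOn
  choose Q hQ using hQ
  let D : ℝ := 1 + ∑ i ∈ Finset.range (j + 1), |Q i|
  have hD1 : 1 ≤ D := by
    have : 0 ≤ ∑ i ∈ Finset.range (j + 1), |Q i| := Finset.sum_nonneg fun i _ => abs_nonneg _
    linarith
  have hD : ∀ i ≤ j, |Q i| ≤ D := by
    intro i hi
    have := Finset.single_le_sum (f := fun i => |Q i|) (fun i _ => abs_nonneg _)
      (Finset.mem_range_succ_iff.2 hi)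
    linarith
  let C : ℝ := ∑ i ∈ Finset.range (j + 1), S i
  refine ⟨j.factorial * C * D ^ j, by
    have := Finset.sum_nonneg fun i (_ : i ∈ Finset.range (j + 1)) => hS0 i
    positivity, fun k hk ξ hξ => ?_⟩
  have hk1 : (1 : ℝ) ≤ k := by exact_mod_cast hk
  -- Faà di Bruno's bound requires the `i`-th derivative of `k * q` to be at most `(k * D) ^ i`. It
  -- is at most `k * D`, which suffices for `i ≥ 1` because `k * D ≥ 1`.
  have h := norm_iteratedFDeriv_comp_le (n := j) (N := ∞) (g := smoothStep)
    (f := fun ξ => (k : ℝ) * q ξ) contDiff_smoothStep (contDiff_const.mul hq)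
    (by exact_mod_cast le_top) ξ (C := C) (D := k * D)
    (fun i hi => (hS i _).trans (Finset.single_le_sum (f := S) (fun i _ => hS0 i)
      (Finset.mem_range_succ_iff.2 hi))) (fun i hi1 hij => ?_)
  · refine h.trans_eq ?_
    rw [mul_pow]
    ring
  · have h1 : iteratedFDeriv ℝ i (fun ξ => (k : ℝ) * q ξ) ξ = (k : ℝ) • iteratedFDeriv ℝ i q ξ :=
      
      iteratedFDeriv_const_smul_apply (f := q) (a := (k : ℝ))
        (hq.of_le (by exact_mod_cast le_top)).contDiffAt
    have h2 : 1 ≤ k * D := one_le_mul_of_one_le_of_one_le hk1 hD1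
    rw [h1, norm_smul, Real.norm_of_nonneg (by positivity)]
    calc (k : ℝ) * ‖iteratedFDeriv ℝ i q ξ‖ ≤ k * D := by
          gcongr
          exact (hQ i ξ (mem_closedBall_zero_iff.2 hξ)).trans ((le_abs_self _).trans (hD i hij))
      _ ≤ (k * D) ^ i := le_self_pow₀ h2 (by omega)

variable [MeasurableSpace E] [BorelSpace E]

/-- The case `d = 0`. With `f ≥ 0` smooth and vanishing exactly on `S`, the cutoffs `smoothStep (k *
f)` are `1` near `S`, so they do not change `v ψ`, but they tend to `0` almost everywhere; dominated
convergence applies to the `L¹` bound. -/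
theorem eq_zero_of_isVanishingOn_of_norm_le_integral {v : 𝓢'(E, ℂ)} {S : Set E}
    (hv : IsVanishingOn v Sᶜ) (hSc : IsClosed S) (hS : volume S = 0) {C : ℝ}
    (hC : ∀ ψ : 𝓢(E, ℂ), ‖v ψ‖ ≤ C * ∫ ξ, ‖ψ ξ‖) : v = 0 := by
  have h0 : IsVanishingOn v Set.univ := by
    refine isVanishingOn_of_forall_hasCompactSupport fun ψ hψ _ => ?_
    obtain ⟨f, hfs, hf, hf0⟩ := hSc.isOpen_compl.exists_contDiff_support_eq (n := ⊤)
    let ζ : ℕ → E → ℂ := fun k ξ => smoothStep (k * f ξ)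
    have hζ : ∀ k, ContDiff ℝ ∞ (ζ k) := fun k =>
      contDiff_smoothStep.comp (contDiff_const.mul hf)
    have hc : ∀ k, HasCompactSupport fun ξ => ζ k ξ * ψ ξ := fun k => hψ.mul_left
    let Ψ : ℕ → 𝓢(E, ℂ) := fun k => (hc k).toSchwartzMap ((hζ k).mul (ψ.smooth ⊤))
    have hΨ : ∀ k ξ, Ψ k ξ = ζ k ξ * ψ ξ := fun k ξ => rfl
    have h1 : ∀ k, v ψ = v (Ψ k) := by
      intro k
      refine hv.eq_of_eqOn (U := {ξ | (k : ℝ) * f ξ < 1 / 2})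
        (isOpen_lt (by fun_prop) continuous_const) (fun ξ hξ => ?_) (fun ξ hξ => ?_)
      · have : f ξ = 0 := by
          by_contra h
          have : ξ ∈ Function.support f := h
          rw [hfs] at this
          exact this hξ
        simp [this]
      · rw [hΨ]
        simp only [ζ]
        rw [smoothStep_of_le (le_of_lt hξ), one_mul]
    have h2 : Filter.Tendsto (fun k => ∫ ξ, ‖Ψ k ξ‖) Filter.atTop (nhds (∫ ξ : E, (0 : ℝ))) := by
      refine tendsto_integral_of_dominated_convergence (fun ξ => ‖ψ ξ‖)
        (fun k => (Ψ k).continuous.norm.aestronglyMeasurable) ψ.integrable.norm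
        (fun k => Filter.Eventually.of_forall fun ξ => ?_) ?_
      · rw [norm_norm, hΨ, norm_mul]
        exact mul_le_of_le_one_left (norm_nonneg _) (norm_smoothStep_le _)
      · filter_upwards [measure_eq_zero_iff_ae_notMem.1 hS] with ξ hξ
        have hpos : 0 < f ξ := by
          have h3 : ξ ∈ Function.support f := by
            rw [hfs]
            exact hξ
          exact lt_of_le_of_ne (hf0 (Set.mem_range_self ξ)).1 (Ne.symm h3)
        refine tendsto_const_nhds.congr' ?_
        obtain ⟨k₀, hk₀⟩ := exists_nat_ge (1 / f ξ)
        filter_upwards [Filter.eventually_ge_atTop k₀] with k hk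
        have hk' : (k₀ : ℝ) ≤ k := by exact_mod_cast hk
        have h4 : ζ k ξ = 0 := smoothStep_of_ge (by
          rw [div_le_iff₀ hpos] at hk₀
          nlinarith)
        rw [hΨ, h4, zero_mul, norm_zero]
    rw [integral_zero] at h2
    have h3 : ‖v ψ‖ ≤ C * 0 := by
      refine ge_of_tendsto (h2.const_mul C) (Filter.Eventually.of_forall fun k => ?_)
      rw [h1 k]
      exact hC _
    rw [mul_zero] at h3
    exact norm_le_zero_iff.1 h3
  ext ψ
  exact h0 ψ (Set.subset_univ _)

/-- If `v` is supported in the ball of radius `a` and is of order `d`, then testing `v` on the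
Fourier coefficients of exponentials gives the size of these coefficients on the ball, up to a loss
of `|m| ^ d`. -/
theorem exists_norm_apply_expFourierCoeff_le {v : 𝓢'(E, ℂ)} {S : Set E}
    (hv : IsVanishingOn v Sᶜ) {a : ℝ} (ha : 0 < a) (hS : ∀ ξ ∈ S, ‖ξ‖ ≤ a) {d : ℕ} {C₀ : ℝ}
    (hC₀ : ∀ ψ : 𝓢(E, ℂ), ‖v ψ‖ ≤ C₀ * ∑ p ∈ Finset.range (d + 1) ×ˢ Finset.range (d + 1),
      ∫ ξ, ‖ξ‖ ^ p.1 * ‖iteratedFDeriv ℝ p.2 ψ ξ‖)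
    (A B : E →L[ℝ] ℂ) {c : ℝ} (hc : 0 < c) (hA : ∀ ξ, ‖A ξ‖ ≤ c * ‖ξ‖)
    (hB : ∀ ξ, ‖B ξ‖ ≤ c * ‖ξ‖) {U : Set E} (hU : IsOpen U) (hSU : S ⊆ U) (Ψ : ℤ → 𝓢(E, ℂ))
    (hΨ : ∀ m, ∀ ξ ∈ U, Ψ m ξ = expFourierCoeff (A ξ) (B ξ) m) :
    ∃ C : ℝ, 0 ≤ C ∧ ∃ M : ℕ, ∀ m : ℤ, M ≤ m.natAbs →
      ‖v (Ψ m)‖ ≤ C * ((m.natAbs : ℝ) ^ d * ((c * a) ^ m.natAbs / m.natAbs.factorial)) := by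
  let q : E → ℝ := fun ξ => ‖ξ‖ ^ 2 - a ^ 2
  have hq : ContDiff ℝ ∞ q := (contDiff_norm_sq ℝ).sub contDiff_const
  -- A radius valid for all `k ≥ 1`: the `k`-th cutoff lives in `‖ξ‖ ≤ a * (1 + 1 / (k * a ^ 2)) ≤ a
  -- + 1 / a`.
  let b : ℝ := a + a⁻¹
  have hb0 : 0 < b := by positivity
  choose Cs hCs0 hCs using exists_norm_iteratedFDeriv_smoothStep_comp_le hq b
  choose Ce hCe0 Me hCe using
    norm_iteratedFDeriv_expFourierCoeff_le A B (t₀ := c * a) (t₁ := c * b) (by positivity)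
  let K : ℕ → ℝ := fun j => ∑ i ∈ Finset.range (j + 1), (j.choose i : ℝ) * Cs i * Ce (j - i)
  have hK0 : ∀ j, 0 ≤ K j := fun j => Finset.sum_nonneg fun i _ => by
    have := hCs0 i
    have := hCe0 (j - i)
    positivity
  let V : ℝ := (volume (Metric.closedBall (0 : E) b)).toReal
  let M : ℕ := 1 + ∑ l ∈ Finset.range (d + 1), Me l
  have hMe : ∀ l ≤ d, Me l ≤ M := fun l hl =>
    (Finset.single_le_sum (f := Me) (fun _ _ => Nat.zero_le _)
      (Finset.mem_range_succ_iff.2 hl)).trans (Nat.le_add_left _ _)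
  have hexp : 0 < Real.exp ((a ^ 2)⁻¹) := Real.exp_pos _
  refine ⟨|C₀| * ∑ p ∈ Finset.range (d + 1) ×ˢ Finset.range (d + 1),
    V * (b ^ p.1 * (K p.2 * Real.exp ((a ^ 2)⁻¹))), ?_, M, fun m hm => ?_⟩
  · refine mul_nonneg (abs_nonneg _) (Finset.sum_nonneg fun p _ => ?_)
    have := hK0 p.2
    positivity
  set k := m.natAbs with hk
  have hk1 : 1 ≤ k := (Nat.le_add_right 1 _).trans hm
  have hk1' : (1 : ℝ) ≤ k := by exact_mod_cast hk1
  let t : ℝ := c * a * (1 + (k * a ^ 2)⁻¹)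
  have ht0 : c * a ≤ t := le_mul_of_one_le_right (by positivity) (by
    have : 0 < ((k : ℝ) * a ^ 2)⁻¹ := by positivity
    linarith)
  have hρ : a * (1 + (k * a ^ 2)⁻¹) ≤ b := by
    have : a * (k * a ^ 2)⁻¹ ≤ a⁻¹ := by
      rw [mul_inv, mul_left_comm, pow_two, mul_inv, mul_inv_cancel_left₀ ha.ne']
      exact mul_le_of_le_one_left (by positivity) (inv_le_one_of_one_le₀ hk1')
    rw [mul_add, mul_one]
    exact add_le_add le_rfl this
  have ht1 : t ≤ c * b := by
    simp only [t]
    rw [mul_assoc]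
    gcongr
  -- Enlarging the ball by a relative amount `1 / (k * a ^ 2)` costs only a constant in the `k`-th
  -- power, since `(1 + x / k) ^ k ≤ exp x`.
  have htk : t ^ k ≤ (c * a) ^ k * Real.exp ((a ^ 2)⁻¹) := by
    simp only [t]
    rw [mul_pow]
    gcongr
    calc (1 + ((k : ℝ) * a ^ 2)⁻¹) ^ k ≤ Real.exp (((k : ℝ) * a ^ 2)⁻¹) ^ k := by
          gcongr
          rw [add_comm]
          exact Real.add_one_le_exp _
      _ = Real.exp ((a ^ 2)⁻¹) := by
          rw [← Real.exp_nat_mul, mul_inv, mul_inv_cancel_left₀ (by positivity)]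
  have hqk : ∀ ξ, (k : ℝ) * q ξ ≤ 1 → ‖ξ‖ ≤ a * (1 + (k * a ^ 2)⁻¹) := by
    intro ξ hξ
    have h1 : ‖ξ‖ ^ 2 ≤ a ^ 2 + (k : ℝ)⁻¹ := by
      have : q ξ ≤ (k : ℝ)⁻¹ := by
        rw [← one_div, le_div_iff₀ (by positivity)]
        linarith
      simp only [q] at this
      linarith
    refine (pow_le_pow_iff_left₀ (norm_nonneg _) (by positivity) two_ne_zero).1 ?_
    refine h1.trans ?_
    have h2 : (a * (1 + (k * a ^ 2)⁻¹)) ^ 2 =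
        a ^ 2 + 2 * (k : ℝ)⁻¹ + (a * (k * a ^ 2)⁻¹) ^ 2 := by
      have : (0 : ℝ) < k := by positivity
      field_simp
      ring
    rw [h2]
    have : 0 < (k : ℝ)⁻¹ := by positivity
    nlinarith [sq_nonneg (a * (k * a ^ 2)⁻¹)]
  -- This cutoff is `1` near the ball of radius `a` and loses a factor `k` per derivative, the same
  -- rate as `Φ`; by Leibniz the product loses at most `k ^ d` in `d` derivatives.
  let χ : E → ℂ := fun ξ => smoothStep (k * q ξ)
  have hχ : ContDiff ℝ ∞ χ := contDiff_smoothStep.comp (contDiff_const.mul hq)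
  have hχ0 : ∀ ξ, ¬ (k : ℝ) * q ξ ≤ 1 → χ ξ = 0 := fun ξ hξ => smoothStep_of_ge (not_le.1 hξ).le
  have hχc : HasCompactSupport χ := by
    refine HasCompactSupport.intro (isCompact_closedBall (0 : E) b) fun ξ hξ => hχ0 ξ fun h => hξ ?_
    exact mem_closedBall_zero_iff.2 ((hqk ξ h).trans hρ)
  let Φ : E → ℂ := fun ξ => expFourierCoeff (A ξ) (B ξ) m
  have hΦ : ContDiff ℝ ∞ Φ := contDiff_expFourierCoeff A B m
  have hc' : HasCompactSupport fun ξ => χ ξ * Φ ξ := hχc.mul_right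
  let Ψ' : 𝓢(E, ℂ) := hc'.toSchwartzMap (hχ.mul hΦ)
  have hΨ' : (Ψ' : E → ℂ) = fun ξ => χ ξ * Φ ξ := rfl
  have hvΨ : v (Ψ m) = v Ψ' := by
    refine hv.eq_of_eqOn (U := U ∩ {ξ | (k : ℝ) * q ξ < 1 / 2})
      (hU.inter (isOpen_lt (by fun_prop) continuous_const)) (fun ξ hξ => ⟨hSU hξ, ?_⟩)
      (fun ξ hξ => ?_)
    · have h1 : q ξ ≤ 0 := sub_nonpos.2 (pow_le_pow_left₀ (norm_nonneg _) (hS ξ hξ) 2)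
      have : (k : ℝ) * q ξ ≤ 0 := mul_nonpos_of_nonneg_of_nonpos (by positivity) h1
      exact this.trans_lt one_half_pos
    · have h2 : (k : ℝ) * q ξ < 1 / 2 := hξ.2
      rw [hΨ m ξ hξ.1, hΨ']
      simp only [χ, Φ]
      rw [smoothStep_of_le h2.le, one_mul]
  have hbound : ∀ j ≤ d, ∀ ξ, ‖iteratedFDeriv ℝ j Ψ' ξ‖ ≤
      K j * ((k : ℝ) ^ d * (t ^ k / k.factorial)) := by
    intro j hj ξ
    have ht : 0 < t := lt_of_lt_of_le (by positivity) ht0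
    by_cases hξ : (k : ℝ) * q ξ ≤ 1
    · have hξ' := hqk ξ hξ
      have hAt : ‖A ξ‖ ≤ t := (hA ξ).trans (by
        simp only [t]
        rw [mul_assoc]
        gcongr)
      have hBt : ‖B ξ‖ ≤ t := (hB ξ).trans (by
        simp only [t]
        rw [mul_assoc]
        gcongr)
      rw [hΨ']
      refine (norm_iteratedFDeriv_mul_le (n := j) (N := ∞) hχ hΦ ξ
        (by exact_mod_cast le_top)).trans ?_
      rw [Finset.sum_mul]
      refine Finset.sum_le_sum fun i hi => ?_
      have hij : i ≤ j := Finset.mem_range_succ_iff.1 hi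
      have h1 := hCs i k hk1 ξ (hξ'.trans hρ)
      have h2 := hCe (j - i) t ⟨ht0, ht1⟩ m ((hMe _ (by omega)).trans hm) ξ hAt hBt
      have h3 : (k : ℝ) ^ i * (k : ℝ) ^ (j - i) ≤ (k : ℝ) ^ d := by
        rw [← pow_add]
        exact pow_le_pow_right₀ hk1' (by omega)
      have := hCs0 i
      have := hCe0 (j - i)
      calc (j.choose i : ℝ) * ‖iteratedFDeriv ℝ i χ ξ‖ * ‖iteratedFDeriv ℝ (j - i) Φ ξ‖
          ≤ (j.choose i : ℝ) * (Cs i * (k : ℝ) ^ i) *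
            (Ce (j - i) * ((k : ℝ) ^ (j - i) * (t ^ k / k.factorial))) := by gcongr
        _ = (j.choose i : ℝ) * Cs i * Ce (j - i) *
            (((k : ℝ) ^ i * (k : ℝ) ^ (j - i)) * (t ^ k / k.factorial)) := by ring
        _ ≤ _ := by gcongr
    · have h0 : (Ψ' : E → ℂ) =ᶠ[nhds ξ] fun _ => 0 := by
        have hop : IsOpen {ξ | 1 < (k : ℝ) * q ξ} := isOpen_lt continuous_const (by fun_prop)
        filter_upwards [hop.mem_nhds (not_le.1 hξ)] with η hη
        rw [hΨ']
        simp only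
        rw [hχ0 η (not_le.2 hη), zero_mul]
      rw [(h0.iteratedFDeriv ℝ j).eq_of_nhds]
      have : iteratedFDeriv ℝ j (fun _ : E => (0 : ℂ)) ξ = 0 := by simp
      rw [this, norm_zero]
      have := hK0 j
      positivity
  have hsupp : ∀ j, ∀ ξ, ξ ∉ Metric.closedBall (0 : E) b → iteratedFDeriv ℝ j Ψ' ξ = 0 := by
    intro j ξ hξ
    have h0 : (Ψ' : E → ℂ) =ᶠ[nhds ξ] fun _ => 0 := by
      filter_upwards [Metric.isClosed_closedBall.isOpen_compl.mem_nhds hξ] with η hη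
      rw [hΨ']
      simp only
      rw [hχ0 η fun h => hη (mem_closedBall_zero_iff.2 ((hqk η h).trans hρ)), zero_mul]
    rw [(h0.iteratedFDeriv ℝ j).eq_of_nhds]
    simp
  have hint : ∀ i j, j ≤ d → ∫ ξ, ‖ξ‖ ^ i * ‖iteratedFDeriv ℝ j Ψ' ξ‖ ≤
      V * (b ^ i * (K j * ((k : ℝ) ^ d * (t ^ k / k.factorial)))) := by
    intro i j hj
    have h1 : ∫ ξ, ‖ξ‖ ^ i * ‖iteratedFDeriv ℝ j Ψ' ξ‖ =
        ∫ ξ in Metric.closedBall (0 : E) b, ‖ξ‖ ^ i * ‖iteratedFDeriv ℝ j Ψ' ξ‖ := by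
      refine (setIntegral_eq_integral_of_forall_compl_eq_zero fun ξ hξ => ?_).symm
      rw [hsupp j ξ hξ, norm_zero, mul_zero]
    rw [h1]
    refine (le_abs_self _).trans ?_
    have h2 := norm_setIntegral_le_of_norm_le_const (μ := volume) (s := Metric.closedBall (0 : E) b)
      (f := fun ξ => ‖ξ‖ ^ i * ‖iteratedFDeriv ℝ j Ψ' ξ‖)
      (C := b ^ i * (K j * ((k : ℝ) ^ d * (t ^ k / k.factorial))))
      measure_closedBall_lt_top fun ξ hξ => ?_
    · rw [mul_comm V]
      exact h2
    · rw [Real.norm_of_nonneg (by positivity)]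
      have h3 := hbound j hj ξ
      have h4 : ‖ξ‖ ≤ b := mem_closedBall_zero_iff.1 hξ
      gcongr
  rw [hvΨ]
  refine (hC₀ Ψ').trans ?_
  rw [mul_assoc, Finset.sum_mul]
  refine (mul_le_mul_of_nonneg_right (le_abs_self C₀)
    (Finset.sum_nonneg fun p _ => integral_nonneg fun ξ => by positivity)).trans ?_
  refine mul_le_mul_of_nonneg_left (Finset.sum_le_sum fun p hp => ?_) (abs_nonneg _)
  have hp2 : p.2 ≤ d := Finset.mem_range_succ_iff.1 (Finset.mem_product.1 hp).2
  refine (hint p.1 p.2 hp2).trans ?_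
  have := hK0 p.2
  calc V * (b ^ p.1 * (K p.2 * ((k : ℝ) ^ d * (t ^ k / k.factorial))))
      ≤ V * (b ^ p.1 * (K p.2 * ((k : ℝ) ^ d *
        ((c * a) ^ k * Real.exp ((a ^ 2)⁻¹) / k.factorial)))) := by gcongr
    _ = _ := by ring
end

/-! ### The symbol, the order of `u`, and the phase on the circle -/

section
open Distribution MeasureTheory FourierTransform

variable {n : ℕ}

theorem one_le_japaneseBracket (x : EuclideanSpace ℝ (Fin n)) : 1 ≤ japaneseBracket x :=
  Real.one_le_sqrt.2 (by nlinarith [sq_nonneg ‖x‖])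

theorem japaneseBracket_le (x : EuclideanSpace ℝ (Fin n)) : japaneseBracket x ≤ 1 + ‖x‖ :=
  Real.sqrt_le_iff.2 ⟨by positivity, by nlinarith [norm_nonneg x]⟩

theorem IsSymbol.hasTemperateGrowth {μ : ℝ} {p : EuclideanSpace ℝ (Fin n) → ℂ}
    (hp : IsSymbol μ p) : p.HasTemperateGrowth := by
  refine ⟨hp.smooth, fun k => ?_⟩
  obtain ⟨C, hC⟩ := hp.bound k
  obtain ⟨K, hK⟩ := exists_nat_ge μ
  refine ⟨K, |C|, fun ξ => (hC ξ).trans ?_⟩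
  have h1 := one_le_japaneseBracket ξ
  calc C * japaneseBracket ξ ^ (μ - (k : ℝ)) ≤ |C| * japaneseBracket ξ ^ (K : ℝ) := by
        gcongr
        · exact le_abs_self C
        · linarith [k.cast_nonneg (α := ℝ)]
    _ ≤ |C| * (1 + ‖ξ‖) ^ K := by
        rw [Real.rpow_natCast]
        gcongr
        exact japaneseBracket_le ξ

/-- The factorization says nothing at the origin, but the lower bound `c * ∏ |‖ξ‖ - r j| ^ q j ≤ ‖p
ξ‖` is a closed condition and extends there by density. -/
theorem ne_zero_of_eq_mul_prod {p g : EuclideanSpace ℝ (Fin n) → ℂ} {N : ℕ} {r : Fin N → ℝ}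
    {q : Fin N → ℕ} (hn : 1 ≤ n) (hp : Continuous p) (hg : IsAdmissibleFactor g)
    (hpg : ∀ ξ, ξ ≠ 0 → p ξ = g ξ * ∏ j, ((‖ξ‖ - r j : ℝ) : ℂ) ^ q j)
    {ξ : EuclideanSpace ℝ (Fin n)} (hξ : ∀ j, ‖ξ‖ ≠ r j) : p ξ ≠ 0 := by
  have : Nonempty (Fin n) := ⟨⟨0, hn⟩⟩
  obtain ⟨c, hc, hcg⟩ := hg.bounded_below
  have hle : ∀ ξ, c * ∏ j, |‖ξ‖ - r j| ^ q j ≤ ‖p ξ‖ := by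
    have hcl : IsClosed {ξ | c * ∏ j, |‖ξ‖ - r j| ^ q j ≤ ‖p ξ‖} :=
      isClosed_le (by fun_prop) (by fun_prop)
    have hd : Dense ({0}ᶜ : Set (EuclideanSpace ℝ (Fin n))) := dense_compl_singleton 0
    intro ξ
    refine hcl.closure_subset_iff.2 (fun η hη => ?_) (hd ξ)
    have h1 := hcg η hη
    rw [Set.mem_ofPred_eq, hpg η hη, norm_mul, norm_prod]
    simp only [norm_pow, Complex.norm_real, Real.norm_eq_abs]
    gcongr
  have hpos : 0 < c * ∏ j, |‖ξ‖ - r j| ^ q j :=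
    mul_pos hc (Finset.prod_pos fun j _ => pow_pos (abs_pos.2 (sub_ne_zero.2 (hξ j))) _)
  exact norm_pos_iff.1 (hpos.trans_le (hle ξ))

theorem isVanishingOn_fourier_of_multiplierOp_eq_zero {p : EuclideanSpace ℝ (Fin n) → ℂ}
    (hp : p.HasTemperateGrowth) {u : 𝓢'(EuclideanSpace ℝ (Fin n), ℂ)}
    (hPu : multiplierOp p u = 0) {r : Set ℝ} (hr : ∀ ξ, ‖ξ‖ ∉ r → p ξ ≠ 0) :
    IsVanishingOn (𝓕 u : 𝓢'(EuclideanSpace ℝ (Fin n), ℂ)) {ξ | 2 * Real.pi * ‖ξ‖ ∈ r}ᶜ := by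
  let p' : EuclideanSpace ℝ (Fin n) → ℂ := fun ξ => p ((2 * Real.pi) • ξ)
  have hp' : p'.HasTemperateGrowth := hp.comp
    (ContinuousLinearMap.hasTemperateGrowth
      ((2 * Real.pi) • ContinuousLinearMap.id ℝ (EuclideanSpace ℝ (Fin n))))
  let w : 𝓢'(EuclideanSpace ℝ (Fin n), ℂ) := TemperedDistribution.smulLeftCLM ℂ p'
    (𝓕 u : 𝓢'(EuclideanSpace ℝ (Fin n), ℂ))
  have h0 : w = 0 := by
    have h1 : (𝓕⁻ w : 𝓢'(EuclideanSpace ℝ (Fin n), ℂ)) = 0 := by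
      rw [← hPu, multiplierOp, TemperedDistribution.fourierMultiplierCLM_apply]
    have h2 : 𝓕 (𝓕⁻ w : 𝓢'(EuclideanSpace ℝ (Fin n), ℂ)) = w := fourier_fourierInv_eq w
    rw [h1] at h2
    rw [← h2]
    ext ψ
    rw [TemperedDistribution.fourier_apply]
    rfl
  refine isVanishingOn_of_forall_hasCompactSupport fun ψ hc hψ =>
    Distribution.eq_zero_of_smulLeftCLM_eq_zero hp' h0 hc fun ξ hξ => hr _ ?_
  rw [norm_smul, Real.norm_of_nonneg Real.two_pi_pos.le]
  exact hψ hξ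

/-- The Fourier transform exchanges the `d` weights with the `d` derivatives and bounds suprema by
`L¹` norms. It is essential that the right side has `L¹` norms: for `d = 0` it does not see null
sets. -/
theorem IsTemperedOfOrder.norm_fourier_apply_le {d : ℕ}
    {u : 𝓢'(EuclideanSpace ℝ (Fin n), ℂ)} (hu : IsTemperedOfOrder d u) :
    ∃ C : ℝ, ∀ ψ : 𝓢(EuclideanSpace ℝ (Fin n), ℂ), ‖𝓕 u ψ‖ ≤ C *
      ∑ p ∈ Finset.range (d + 1) ×ˢ Finset.range (d + 1),
        ∫ ξ, ‖ξ‖ ^ p.1 * ‖iteratedFDeriv ℝ p.2 ψ ξ‖ := by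
  obtain ⟨C, hC⟩ := hu
  refine ⟨|C| * ∑ k ∈ Finset.range (d + 1), 2 ^ (d - 1) * (((2 * Real.pi) ^ k * (2 * k + 2) ^ 0) +
    ((2 * Real.pi) ^ k * (2 * k + 2) ^ d)), fun ψ => ?_⟩
  let S : ℝ := ∑ p ∈ Finset.range (d + 1) ×ˢ Finset.range (d + 1),
        ∫ ξ, ‖ξ‖ ^ p.1 * ‖iteratedFDeriv ℝ p.2 ψ ξ‖
  have hS : 0 ≤ S := Finset.sum_nonneg fun p _ => integral_nonneg fun ξ => by positivity
  have hF : ∀ k ≤ d, ∀ l ≤ d, ∀ x, ‖x‖ ^ l * ‖iteratedFDeriv ℝ k (𝓕 ψ : 𝓢(_, ℂ)) x‖ ≤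
      ((2 * Real.pi) ^ k * (2 * k + 2) ^ l) * S := by
    intro k hk l hl x
    have h1 := Real.pow_mul_norm_iteratedFDeriv_fourier_le (f := ψ) (K := ⊤) (N := ⊤)
      (ψ.smooth ⊤) (fun k n _ _ => ψ.integrable_pow_mul_iteratedFDeriv volume k n)
      (k := k) (n := l) le_top le_top x
    rw [← SchwartzMap.fourier_coe] at h1
    refine h1.trans (mul_le_mul_of_nonneg_left (Finset.sum_le_sum_of_subset_of_nonneg ?_
      fun p _ _ => integral_nonneg fun ξ => by positivity) (by positivity))
    exact Finset.product_subset_product (Finset.range_mono (by omega)) (Finset.range_mono (by omega))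
  rw [TemperedDistribution.fourier_apply]
  refine (hC _).trans ?_
  refine (mul_le_mul_of_nonneg_right (le_abs_self C) (Finset.sum_nonneg fun k _ =>
    Real.iSup_nonneg fun x => by
      have := one_le_japaneseBracket x
      positivity)).trans ?_
  rw [mul_assoc, Finset.sum_mul]
  refine mul_le_mul_of_nonneg_left (Finset.sum_le_sum fun k hk => ciSup_le fun x => ?_)
    (abs_nonneg C)
  have hk' : k ≤ d := Finset.mem_range_succ_iff.1 hk
  have h0 := one_le_japaneseBracket x
  calc japaneseBracket x ^ d * ‖iteratedFDeriv ℝ k (𝓕 ψ : 𝓢(_, ℂ)) x‖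
      ≤ (2 ^ (d - 1) * (1 ^ d + ‖x‖ ^ d)) * ‖iteratedFDeriv ℝ k (𝓕 ψ : 𝓢(_, ℂ)) x‖ := by
        gcongr
        exact (pow_le_pow_left₀ (by linarith) (japaneseBracket_le x) d).trans
          (add_pow_le zero_le_one (norm_nonneg _) d)
    _ = 2 ^ (d - 1) * (‖x‖ ^ 0 * ‖iteratedFDeriv ℝ k (𝓕 ψ : 𝓢(_, ℂ)) x‖ +
          ‖x‖ ^ d * ‖iteratedFDeriv ℝ k (𝓕 ψ : 𝓢(_, ℂ)) x‖) := by
        rw [one_pow, pow_zero]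
        ring
    _ ≤ 2 ^ (d - 1) * (((2 * Real.pi) ^ k * (2 * k + 2) ^ 0) * S +
          ((2 * Real.pi) ^ k * (2 * k + 2) ^ d) * S) := by
        exact mul_le_mul_of_nonneg_left (add_le_add (hF k hk' 0 (Nat.zero_le _) x)
          (hF k hk' d le_rfl x)) (by positivity)
    _ = _ := by ring

/-- The fundamental lemma of the calculus of variations, then continuity. It makes the trace
independent of the representative. -/
theorem IsSmoothOn.eqOn {u : 𝓢'(EuclideanSpace ℝ (Fin n), ℂ)}
    {Ω : Set (EuclideanSpace ℝ (Fin n))} {U V : EuclideanSpace ℝ (Fin n) → ℂ} (hΩ : IsOpen Ω)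
    (hU : IsSmoothOn u Ω U) (hV : IsSmoothOn u Ω V) : Set.EqOn U V Ω := by
  have hUc := hU.1.continuousOn
  have hVc := hV.1.continuousOn
  have hint : ∀ {W : EuclideanSpace ℝ (Fin n) → ℂ}, ContinuousOn W Ω →
      ∀ g : EuclideanSpace ℝ (Fin n) → ℝ, Continuous g → HasCompactSupport g → tsupport g ⊆ Ω →
      Integrable fun x => g x • W x := by
    intro W hW g hg hgc hgΩ
    have hsupp : Function.support (fun x => g x • W x) ⊆ tsupport g := fun x hx =>
      subset_tsupport g fun h => hx (by simp [h])
    refine (integrableOn_iff_integrable_of_support_subset hsupp).1 ?_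
    exact (hg.continuousOn.smul (hW.mono hgΩ)).integrableOn_compact hgc
  have hae : ∀ᵐ x ∂(volume : Measure (EuclideanSpace ℝ (Fin n))), x ∈ Ω → U x - V x = 0 := by
    refine hΩ.ae_eq_zero_of_integral_contDiff_smul_eq_zero
      ((hUc.sub hVc).locallyIntegrableOn hΩ.measurableSet) fun g hg hgc hgΩ => ?_
    have hs : ContDiff ℝ ∞ fun x => (g x : ℂ) := Complex.ofRealCLM.contDiff.comp hg
    have hc : HasCompactSupport fun x => (g x : ℂ) :=
      hgc.comp_left (g := fun x : ℝ => (x : ℂ)) Complex.ofReal_zero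
    have ht : tsupport (fun x => (g x : ℂ)) ⊆ Ω := by
      refine (closure_mono fun x hx => ?_).trans hgΩ
      exact fun h => hx (by simp [h])
    have h1 := hU.2 (hc.toSchwartzMap hs) hc ht
    have h2 := hV.2 (hc.toSchwartzMap hs) hc ht
    simp only [smul_sub]
    rw [integral_sub (hint hUc g hg.continuous hgc hgΩ) (hint hVc g hg.continuous hgc hgΩ),
      sub_eq_zero]
    simp only [Complex.real_smul]
    exact h1.symm.trans h2
  refine Measure.eqOn_open_of_ae_eq (μ := volume) ?_ hΩ hUc hVc
  rw [Filter.EventuallyEq, ae_restrict_iff' hΩ.measurableSet]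
  filter_upwards [hae] with x hx hxΩ using sub_eq_zero.1 (hx hxΩ)

/-- The coefficient of `e^{iθ}` in `2πi x(θ)·ξ`, where `x(θ)` runs through the circle of radius `R`
spanned by `e₁` and `e₂`; that of `e^{-iθ}` is obtained by replacing `e₂` by `-e₂`. -/
noncomputable def circlePhase (R : ℝ) (e₁ e₂ : EuclideanSpace ℝ (Fin n)) :
    EuclideanSpace ℝ (Fin n) →L[ℝ] ℂ :=
  (Real.pi * R * Complex.I : ℂ) • (Complex.ofRealCLM ∘L innerSL ℝ e₁ -
    Complex.I • (Complex.ofRealCLM ∘L innerSL ℝ e₂))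

theorem circlePhase_apply (R : ℝ) (e₁ e₂ ξ : EuclideanSpace ℝ (Fin n)) :
    circlePhase R e₁ e₂ ξ =
      Real.pi * R * Complex.I * ((inner ℝ e₁ ξ : ℝ) - Complex.I * (inner ℝ e₂ ξ : ℝ)) := by
  simp [circlePhase]

theorem norm_circlePhase_le {R : ℝ} (hR : 0 < R) {e₁ e₂ : EuclideanSpace ℝ (Fin n)}
    (he : ∀ ξ, inner ℝ e₁ ξ ^ 2 + inner ℝ e₂ ξ ^ 2 ≤ ‖ξ‖ ^ 2) (ξ : EuclideanSpace ℝ (Fin n)) :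
    ‖circlePhase R e₁ e₂ ξ‖ ≤ Real.pi * R * ‖ξ‖ := by
  have h1 : ‖((inner ℝ e₁ ξ : ℝ) : ℂ) - Complex.I * (inner ℝ e₂ ξ : ℝ)‖ ≤ ‖ξ‖ := by
    refine (pow_le_pow_iff_left₀ (norm_nonneg _) (norm_nonneg _) two_ne_zero).1 ?_
    rw [← Complex.normSq_eq_norm_sq, Complex.normSq_apply]
    refine le_trans (le_of_eq ?_) (he ξ)
    simp
    ring
  rw [circlePhase_apply, norm_mul]
  have h2 : ‖(Real.pi * R * Complex.I : ℂ)‖ = Real.pi * R := by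
    rw [norm_mul, Complex.norm_I, mul_one, norm_mul, Complex.norm_real, Complex.norm_real,
      Real.norm_of_nonneg Real.pi_pos.le, Real.norm_of_nonneg hR.le]
  rw [h2]
  gcongr

theorem circlePhase_mul_exp_add (R : ℝ) (e₁ e₂ ξ : EuclideanSpace ℝ (Fin n)) (θ : ℝ) :
    circlePhase R e₁ e₂ ξ * Complex.exp (Complex.I * θ) +
      circlePhase R e₁ (-e₂) ξ * Complex.exp (-(Complex.I * θ)) =
      (2 * Real.pi * inner ℝ (circlePoint R e₁ e₂ θ) ξ : ℝ) * Complex.I := by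
  have h1 : Complex.exp (Complex.I * θ) = Complex.cos θ + Complex.sin θ * Complex.I := by
    rw [mul_comm, Complex.exp_mul_I]
  have h2 : Complex.exp (-(Complex.I * θ)) = Complex.cos θ - Complex.sin θ * Complex.I := by
    rw [mul_comm, ← neg_mul, Complex.exp_mul_I, Complex.cos_neg, Complex.sin_neg]
    ring
  rw [circlePhase_apply, circlePhase_apply, h1, h2, circlePoint, inner_add_left,
    inner_smul_left, inner_smul_left, inner_neg_left]
  simp only [conj_trivial]
  push_cast
  linear_combination (-2 * Real.pi * R * (inner ℝ e₂ ξ : ℝ) * Complex.sin θ * Complex.I) *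
    Complex.I_sq

/-- The finitely many exceptional `m` are absorbed by adding their ratios `a m / b m` to the
constant. -/
theorem exists_le_mul_of_forall_natAbs_ge {a b : ℤ → ℝ} (hb : ∀ m, 0 < b m) (ha : ∀ m, 0 ≤ a m)
    {C : ℝ} {M : ℕ} (h : ∀ m : ℤ, M ≤ m.natAbs → a m ≤ C * b m) : ∃ c, ∀ m, a m ≤ c * b m := by
  have hs : ∀ m, 0 ≤ a m / b m := fun m => div_nonneg (ha m) (hb m).le
  refine ⟨|C| + ∑ m ∈ Finset.Icc (-(M : ℤ)) M, a m / b m, fun m => ?_⟩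
  have hsum : 0 ≤ ∑ m ∈ Finset.Icc (-(M : ℤ)) M, a m / b m := Finset.sum_nonneg fun m _ => hs m
  rcases le_total M m.natAbs with hm | hm
  · refine (h m hm).trans (mul_le_mul_of_nonneg_right ?_ (hb m).le)
    linarith [le_abs_self C]
  · have h1 := Finset.single_le_sum (f := fun m => a m / b m) (fun m _ => hs m)
      (Finset.mem_Icc.2 (by omega) : m ∈ Finset.Icc (-(M : ℤ)) M)
    rw [← div_le_iff₀ (hb m)]
    linarith [abs_nonneg C]
end

/-! ### Circle coefficients as values of the Fourier transform -/

section
open Distribution MeasureTheory FourierTransform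

variable {n : ℕ}

theorem exists_isSmoothOn_univ {u : 𝓢'(EuclideanSpace ℝ (Fin n), ℂ)}
    {S : Set (EuclideanSpace ℝ (Fin n))}
    (hv : IsVanishingOn (𝓕 u : 𝓢'(EuclideanSpace ℝ (Fin n), ℂ)) Sᶜ) {a : ℝ}
    (hS : ∀ ξ ∈ S, ‖ξ‖ < a) :
    ∃ U : EuclideanSpace ℝ (Fin n) → ℂ, IsSmoothOn u Set.univ U ∧
      ∀ (R : ℝ) (e₁ e₂ : EuclideanSpace ℝ (Fin n)),
        ∃ Ψ : ℤ → 𝓢(EuclideanSpace ℝ (Fin n), ℂ),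
          (∀ m, ∀ ξ ∈ Metric.ball 0 a,
            Ψ m ξ = expFourierCoeff (circlePhase R e₁ e₂ ξ) (circlePhase R e₁ (-e₂) ξ) m) ∧
          ∀ m, circleFourierCoeff R e₁ e₂ U m = 𝓕 u (Ψ m) := by
  obtain ⟨χ, hχ, hχc, hχ1⟩ :=
    exists_contDiff_hasCompactSupport_eq_one (E := EuclideanSpace ℝ (Fin n)) a
  have hSU : S ⊆ Metric.ball 0 a := fun ξ hξ => mem_ball_zero_iff.2 (hS ξ hξ)
  have hχU : ∀ ξ ∈ Metric.ball (0 : EuclideanSpace ℝ (Fin n)) a, χ ξ = 1 := fun ξ hξ =>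
    hχ1 ξ (mem_ball_zero_iff.1 hξ).le
  have htg : χ.HasTemperateGrowth := hχc.hasTemperateGrowth hχ
  have hu : ∀ ψ : 𝓢(EuclideanSpace ℝ (Fin n), ℂ),
      𝓕 u (SchwartzMap.smulLeftCLM ℂ χ ψ) = 𝓕 u ψ := fun ψ =>
    hv.eq_of_eqOn Metric.isOpen_ball hSU fun ξ hξ => by
      rw [SchwartzMap.smulLeftCLM_apply_apply htg, hχU ξ hξ, one_smul]
  obtain ⟨U, K, hU, hrep⟩ := exists_contDiff_integral_eq u hχ hχc hu
  refine ⟨U, ⟨hU.contDiffOn, fun φ _ _ => ?_⟩, fun R e₁ e₂ => ?_⟩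
  -- Averaging over the whole space with weight `φ` produces the test function `χ * 𝓕⁻ φ`, on which
  -- `𝓕 u` takes the value `u φ`.
  · have h := hrep volume measurable_id φ.integrable
      (SchwartzMap.integrable_one_add_norm_pow_mul_norm φ K)
      (SchwartzMap.smulLeftCLM ℂ χ (𝓕⁻ φ)) fun ξ => by
        rw [SchwartzMap.smulLeftCLM_apply_apply htg, SchwartzMap.fourierInv_coe,
          Real.fourierInv_eq', smul_eq_mul]
        congr 1
        refine integral_congr_ae (Filter.Eventually.of_forall fun x => ?_)
        simp only [smul_eq_mul, id_eq]
        ring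
    rw [hu, TemperedDistribution.fourier_apply, fourier_fourierInv_eq] at h
    exact h.symm
  · have hE : ∀ m, ContDiff ℝ ∞ fun ξ =>
        expFourierCoeff (circlePhase R e₁ e₂ ξ) (circlePhase R e₁ (-e₂) ξ) m :=
      fun m => contDiff_expFourierCoeff _ _ m
    have hc : ∀ m, HasCompactSupport fun ξ =>
        χ ξ * expFourierCoeff (circlePhase R e₁ e₂ ξ) (circlePhase R e₁ (-e₂) ξ) m :=
      fun m => hχc.mul_right
    refine ⟨fun m => (hc m).toSchwartzMap (hχ.mul (hE m)), fun m ξ hξ => ?_, fun m => ?_⟩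
    · change χ ξ * _ = _
      rw [hχU ξ hξ, one_mul]
    · have hX : Continuous (circlePoint R e₁ e₂) := by
        unfold circlePoint
        fun_prop
      have hcc : Continuous fun θ : ℝ => Complex.exp (-(Complex.I * (m : ℂ) * (θ : ℂ))) := by
        fun_prop
      -- The same formula averaged over the circle with weight `e^{-imθ}`.
      have h := hrep (volume.restrict (Set.Ioc 0 (2 * Real.pi))) hX.measurable
        (c := fun θ : ℝ => Complex.exp (-(Complex.I * (m : ℂ) * (θ : ℂ))))
        ((hcc.integrableOn_Icc).mono_set Set.Ioc_subset_Icc_self)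
        (((by fun_prop : Continuous fun θ : ℝ => (1 + ‖circlePoint R e₁ e₂ θ‖) ^ K *
          ‖Complex.exp (-(Complex.I * (m : ℂ) * (θ : ℂ)))‖).integrableOn_Icc).mono_set
            Set.Ioc_subset_Icc_self)
        ((hc m).toSchwartzMap (hχ.mul (hE m))) fun ξ => by
          change χ ξ * _ = _
          rw [expFourierCoeff, intervalIntegral.integral_of_le Real.two_pi_pos.le]
          simp only [circlePhase_mul_exp_add]
      rw [← h, circleFourierCoeff, intervalIntegral.integral_of_le Real.two_pi_pos.le]

theorem volume_setOf_mul_norm_mem_eq_zero {E : Type*} [NormedAddCommGroup E]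
    [InnerProductSpace ℝ E] [MeasurableSpace E] [BorelSpace E] [FiniteDimensional ℝ E]
    [Nontrivial E] {c : ℝ} (hc : c ≠ 0) {s : Set ℝ} (hs : s.Finite) :
    volume {ξ : E | c * ‖ξ‖ ∈ s} = 0 := by
  have h : {ξ : E | c * ‖ξ‖ ∈ s} ⊆ ⋃ t ∈ s, Metric.sphere (0 : E) (t / c) := by
    intro ξ hξ
    simp only [Set.mem_iUnion, mem_sphere_zero_iff_norm]
    exact ⟨_, hξ, by field_simp⟩
  refine measure_mono_null h ((measure_biUnion_null_iff hs.countable).2 fun t _ => ?_)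
  exact Measure.addHaar_sphere _ _ _

theorem Orthonormal.inner_sq_add_inner_sq_le {E : Type*} [NormedAddCommGroup E]
    [InnerProductSpace ℝ E] {e₁ e₂ : E} (he : Orthonormal ℝ ![e₁, e₂]) (ξ : E) :
    inner ℝ e₁ ξ ^ 2 + inner ℝ e₂ ξ ^ 2 ≤ ‖ξ‖ ^ 2 := by
  have h := he.sum_inner_products_le (s := Finset.univ) ξ
  simpa [Fin.sum_univ_two] using h

end

/-! ### Comparison with the Bessel functions -/

section
open Distribution MeasureTheory FourierTransform

/-- Only the largest radius `r j₀` matters. With `a = r j₀ / (2π)` and `c = πR` the product `c * a`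
is `r j₀ * R / 2`, the base in the leading term of the Bessel function. The term with `J_{m+1}`
serves only to keep the right side positive for small `|m|`. -/
theorem exists_norm_apply_le_mul_besselJ {n : ℕ} {v : 𝓢'(EuclideanSpace ℝ (Fin n), ℂ)} {N : ℕ}
    {r : Fin N → ℝ} (hr : ∀ j, 0 < r j) (j₀ : Fin N) (hj₀ : ∀ j, r j ≤ r j₀)
    (hv : IsVanishingOn v {ξ | 2 * Real.pi * ‖ξ‖ ∈ Set.range r}ᶜ) {d : ℕ} (hd : 1 ≤ d) {C₀ : ℝ}
    (hC₀ : ∀ ψ : 𝓢(EuclideanSpace ℝ (Fin n), ℂ), ‖v ψ‖ ≤ C₀ *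
      ∑ p ∈ Finset.range (d + 1) ×ˢ Finset.range (d + 1),
        ∫ ξ, ‖ξ‖ ^ p.1 * ‖iteratedFDeriv ℝ p.2 ψ ξ‖)
    {R : ℝ} (hR : 0 < R) {e₁ e₂ : EuclideanSpace ℝ (Fin n)} (he : Orthonormal ℝ ![e₁, e₂])
    {U : Set (EuclideanSpace ℝ (Fin n))} (hU : IsOpen U)
    (hSU : {ξ | 2 * Real.pi * ‖ξ‖ ∈ Set.range r} ⊆ U) {Ψ : ℤ → 𝓢(EuclideanSpace ℝ (Fin n), ℂ)}
    (hΨ : ∀ m, ∀ ξ ∈ U,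
      Ψ m ξ = expFourierCoeff (circlePhase R e₁ e₂ ξ) (circlePhase R e₁ (-e₂) ξ) m) :
    ∃ c : ℝ, ∀ m : ℤ, ‖v (Ψ m)‖ ≤ c * ∑ j, (max 1 (|(m : ℝ)| ^ d) * |besselJ m (r j * R)| +
      (if 1 ≤ d then (1 : ℝ) else 0) *
        (max 1 (|(m : ℝ)| ^ (d - 1)) * |besselJ (m + 1) (r j * R)|)) := by
  have hx : 0 < r j₀ * R := mul_pos (hr j₀) hR
  obtain ⟨C, hC, M₁, hM₁⟩ := exists_norm_apply_expFourierCoeff_le hv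
    (a := r j₀ / (2 * Real.pi)) (div_pos (hr j₀) Real.two_pi_pos) (fun ξ hξ => by
      obtain ⟨j, hj⟩ := hξ
      rw [le_div_iff₀ Real.two_pi_pos, mul_comm, ← hj]
      exact hj₀ j) hC₀ (circlePhase R e₁ e₂) (circlePhase R e₁ (-e₂)) (c := Real.pi * R)
    (mul_pos Real.pi_pos hR) (norm_circlePhase_le hR he.inner_sq_add_inner_sq_le)
    (norm_circlePhase_le hR fun ξ => by
      rw [inner_neg_left, neg_sq]
      exact he.inner_sq_add_inner_sq_le ξ) hU hSU Ψ hΨ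
  obtain ⟨M₂, hM₂⟩ := exists_half_le_besselJNat hx.le
  have hterm : ∀ (m : ℤ) (j : Fin N), 0 ≤ max 1 (|(m : ℝ)| ^ d) * |besselJ m (r j * R)| +
      (if 1 ≤ d then (1 : ℝ) else 0) *
        (max 1 (|(m : ℝ)| ^ (d - 1)) * |besselJ (m + 1) (r j * R)|) := fun m j => by
    rw [if_pos hd]
    positivity
  have hle := fun m : ℤ => Finset.single_le_sum (fun j _ => hterm m j) (Finset.mem_univ j₀)
  refine exists_le_mul_of_forall_natAbs_ge (C := C * 2) (M := max M₁ M₂) (fun m => ?_)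
    (fun m => norm_nonneg _) fun m hm => ?_
  · refine lt_of_lt_of_le ?_ (hle m)
    rw [if_pos hd, one_mul]
    refine (abs_besselJ_add_pos m hx).trans_le (add_le_add ?_ ?_) <;>
      exact le_mul_of_one_le_left (abs_nonneg _) (le_max_left _ _)
  · refine (hM₁ m ((le_max_left _ _).trans hm)).trans ?_
    rw [mul_assoc C 2]
    refine mul_le_mul_of_nonneg_left (le_trans ?_ (mul_le_mul_of_nonneg_left (hle m) two_pos.le)) hC
    have h1 := hM₂ m.natAbs ((le_max_right _ _).trans hm)
    have h2 : Real.pi * R * (r j₀ / (2 * Real.pi)) = r j₀ * R / 2 := by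
      field_simp
    rw [h2]
    have h3 : (r j₀ * R / 2) ^ m.natAbs / m.natAbs.factorial ≤ 2 * |besselJ m (r j₀ * R)| := by
      rw [abs_besselJ]
      linarith [le_abs_self (besselJNat m.natAbs (r j₀ * R))]
    have h4 : (m.natAbs : ℝ) ^ d ≤ max 1 (|(m : ℝ)| ^ d) := by
      rw [Nat.cast_natAbs, Int.cast_abs]
      exact le_max_right _ _
    have h5 := mul_le_mul h4 h3 (by positivity) (by positivity)
    have h6 : 0 ≤ (if 1 ≤ d then (1 : ℝ) else 0) *
        (max 1 (|(m : ℝ)| ^ (d - 1)) * |besselJ (m + 1) (r j₀ * R)|) := by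
      rw [if_pos hd]
      positivity
    linarith

end

theorem theorem2 (n : ℕ) (hn : 2 ≤ n)
    -- the elliptic symbol `p = g ∏ (|ξ| - r_j)^{q_j}` of order `μ`
    (μ : ℝ) (p g : EuclideanSpace ℝ (Fin n) → ℂ)
    (N : ℕ) (r : Fin N → ℝ) (q : Fin N → ℕ)
    (hp : IsSymbol μ p) (hell : IsEllipticSymbol μ p) (hg : IsAdmissibleFactor g)
    (hr_pos : ∀ j, 0 < r j) (hr_mono : StrictMono r) (hq : ∀ j, 1 ≤ q j)
    (hpg : ∀ ξ, ξ ≠ 0 → p ξ = g ξ * ∏ j, ((‖ξ‖ - r j : ℝ) : ℂ) ^ q j)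
    -- the circle
    (R : ℝ) (hR : 0 < R) (e₁ e₂ : EuclideanSpace ℝ (Fin n))
    (he : Orthonormal ℝ ![e₁, e₂])
    -- the solution
    (d : ℕ) (u : 𝓢'(EuclideanSpace ℝ (Fin n), ℂ)) (hu : IsTemperedOfOrder d u)
    (hPu : multiplierOp p u = 0) :
    -- `u` is smooth near the circle, so that its trace makes sense
    (∃ (Ω : Set (EuclideanSpace ℝ (Fin n))) (U : EuclideanSpace ℝ (Fin n) → ℂ),
      IsOpen Ω ∧ (∀ θ : ℝ, circlePoint R e₁ e₂ θ ∈ Ω) ∧ IsSmoothOn u Ω U) ∧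
    -- and the Fourier coefficients of the trace satisfy the estimate
    ∃ c : ℝ, ∀ (Ω : Set (EuclideanSpace ℝ (Fin n))) (U : EuclideanSpace ℝ (Fin n) → ℂ),
      IsOpen Ω → (∀ θ : ℝ, circlePoint R e₁ e₂ θ ∈ Ω) → IsSmoothOn u Ω U →
      ∀ m : ℤ, ‖circleFourierCoeff R e₁ e₂ U m‖ ≤
        c * ∑ j, (max 1 (|(m : ℝ)| ^ d) * |besselJ m (r j * R)| +
          (if 1 ≤ d then (1 : ℝ) else 0) *
            (max 1 (|(m : ℝ)| ^ (d - 1)) * |besselJ (m + 1) (r j * R)|)) := by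
  have : Nonempty (Fin n) := ⟨⟨0, by omega⟩⟩
  set v : 𝓢'(EuclideanSpace ℝ (Fin n), ℂ) := FourierTransform.fourier u with hv_def
  set S : Set (EuclideanSpace ℝ (Fin n)) := {ξ | 2 * Real.pi * ‖ξ‖ ∈ Set.range r} with hS_def
  have hv : Distribution.IsVanishingOn v Sᶜ :=
    isVanishingOn_fourier_of_multiplierOp_eq_zero hp.hasTemperateGrowth hPu fun ξ hξ =>
      ne_zero_of_eq_mul_prod (by omega) hp.smooth.continuous hg hpg fun j h => hξ ⟨j, h.symm⟩
  have hSfin : (Set.range r).Finite := Set.finite_range r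
  have hSclosed : IsClosed S :=
    hSfin.isClosed.preimage (by fun_prop : Continuous fun ξ : EuclideanSpace ℝ (Fin n) =>
      2 * Real.pi * ‖ξ‖)
  have hSnull : MeasureTheory.volume S = 0 :=
    volume_setOf_mul_norm_mem_eq_zero Real.two_pi_pos.ne' hSfin
  obtain ⟨b, hb⟩ : ∃ b, ∀ ξ ∈ S, ‖ξ‖ < b := by
    refine ⟨(∑ j, r j) / (2 * Real.pi) + 1, fun ξ ⟨j, hj⟩ => ?_⟩
    have h1 : ‖ξ‖ ≤ (∑ j, r j) / (2 * Real.pi) := by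
      rw [le_div_iff₀ Real.two_pi_pos, mul_comm, ← hj]
      exact Finset.single_le_sum (fun j _ => (hr_pos j).le) (Finset.mem_univ j)
    linarith
  obtain ⟨U₁, hU₁, hcoeff⟩ := exists_isSmoothOn_univ hv hb
  obtain ⟨Ψ, hΨ, hcΨ⟩ := hcoeff R e₁ e₂
  obtain ⟨C₀, hC₀⟩ := hu.norm_fourier_apply_le
  refine ⟨⟨Set.univ, U₁, isOpen_univ, fun _ => trivial, hU₁⟩, ?_⟩
  have main : ∃ c : ℝ, ∀ m : ℤ, ‖v (Ψ m)‖ ≤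
      c * ∑ j, (max 1 (|(m : ℝ)| ^ d) * |besselJ m (r j * R)| +
        (if 1 ≤ d then (1 : ℝ) else 0) *
          (max 1 (|(m : ℝ)| ^ (d - 1)) * |besselJ (m + 1) (r j * R)|)) := by
    -- Without spheres the sum is empty, and `v` vanishes everywhere.
    rcases isEmpty_or_nonempty (Fin N) with hN | hN
    · refine ⟨0, fun m => ?_⟩
      have h0 : v (Ψ m) = 0 := hv _ fun ξ _ hξ => by
        obtain ⟨j, -⟩ := hξ
        exact hN.elim j
      rw [h0, norm_zero, zero_mul]
    -- For `d = 0` the terms with `J_{m+1}` are absent and the right side may vanish, but here `v =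
    -- 0`.
    rcases Nat.eq_zero_or_pos d with hd | hd
    · refine ⟨0, fun m => ?_⟩
      have h0 : v = 0 := eq_zero_of_isVanishingOn_of_norm_le_integral hv hSclosed hSnull
        (C := C₀) fun ψ => by
          have h := hC₀ ψ
          subst hd
          simpa [hv_def] using h
      rw [h0, zero_mul]
      exact norm_zero.le
    · obtain ⟨j₀, hj₀⟩ := Finite.exists_max r
      exact exists_norm_apply_le_mul_besselJ hr_pos j₀ hj₀ hv hd hC₀ hR he Metric.isOpen_ball
        (fun ξ hξ => mem_ball_zero_iff.2 (hb ξ hξ)) hΨ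
  obtain ⟨c, hc⟩ := main
  refine ⟨c, fun Ω U hΩ hcirc hU m => ?_⟩
  have hU₁Ω : IsSmoothOn u Ω U₁ :=
    ⟨hU₁.1.mono (Set.subset_univ _), fun φ hφ _ => hU₁.2 φ hφ (Set.subset_univ _)⟩
  have hUU₁ := hU.eqOn hΩ hU₁Ω
  have h : circleFourierCoeff R e₁ e₂ U m = circleFourierCoeff R e₁ e₂ U₁ m := by
    unfold circleFourierCoeff
    simp only [hUU₁ (hcirc _)]
  rw [h, hcΨ]
  exact hc m
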